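/- Let $K$ be a field and let $\mathbf{Q}$ be the poset of non-negative rational numbers. A functor $F\colon\mathbf{Q}\to\mathrm{Vect}_K$ is called *tame* if, for some rational $\alpha>0$, it is isomorphic to $v\mapsto G(\lfloor v/\alpha\rfloor)$ for a functor $G\colon\mathbf{N}\to\mathrm{Vect}_K$. It is called *compact* if any sequence of subfunctors $A_0\subset A_1\subset\cdots\subset F$ with union $F$ has $A_k=F$ for some $k$. Let $K(i,-)$ denote the functor with value $K$ at $v\ge i$ (with identities between these values) and $0$ elsewhere. A functor $G$ has *rank* $n$ if there is an epimorphism $\phi\colon\bigoplus_{k=1}^n K(i_k,-)\to G$ that is minimal, i.e. every endomorphism $f$ of its source with $\phi f=\phi$ is an isomorphism; $\mathrm{rank}(G)=\infty$ if there is no such $n$. A *noise system* is a family $\{\mathcal S_\epsilon\}_{\epsilon\in\mathbf{Q}}$ of collections of tame functors such that the zero functor lies in every $\mathcal S_\epsilon$; $\mathcal S_\tau\subset\mathcal S_\epsilon$ for $\tau<\epsilon$; and for every exact sequence $0\to F'\to G\to H\to 0$ of tame functors, $G\in\mathcal S_\epsilon$ implies $F',H\in\mathcal S_\epsilon$, while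 $F'\in\mathcal S_\epsilon$ and $H\in\mathcal S_\tau$ imply $G\in\mathcal S_{\epsilon+\tau}$. A natural transformation $\phi$ of tame functors is an *$\epsilon$-equivalence* if $\ker\phi\in\mathcal S_\tau$ and $\mathrm{coker}\,\phi\in\mathcal S_\mu$ for some $\tau+\mu\le\epsilon$. Tame functors $F,G$ are *$\epsilon$-close* if there are a tame $H$, a $\tau$-equivalence $H\to F$ and a $\mu$-equivalence $H\to G$ with $\tau+\mu\le\epsilon$. Let $d(F,G)\in[0,\infty]$ be the infimum of all $\epsilon\in\mathbf{Q}$ for which $F,G$ are $\epsilon$-close, and let $B(F,t)$ be the set of tame $G$ with $d(F,G)<t$. For tame compact $F$ put $\mathrm{bar}(F)_0=\mathrm{rank}(F)$ and $\mathrm{bar}(F)_t=\min\{\mathrm{rank}(G)\mid G\in B(F,t)\}$ for $t>0$. Let $F[\mathcal S_\tau]\subset F$ be the sum of all subfunctors of $F$ that belong to $\mathcal S_\tau$ (this is the unique maximal subfunctor of $F$ belonging to $\mathcal S_\tau$ whenever such a subfunctor exists), and let $F[\mathcal S_{<t}]=\bigcup_{\tau<t}F[\mathcal S_\tau]$ (the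 zero subfunctor if $t=0$). **Statement.** Suppose every $\mathcal S_\epsilon$ is closed under (binary) direct sums, and let $F\colon\mathbf{Q}\to\mathrm{Vect}_K$ be tame and compact. Then for every $t\in\mathbf{Q}$ the cokernel of the inclusion $F[\mathcal S_{<t}]\subset F$ has finite rank and $$\mathrm{bar}(F)_t=\mathrm{rank}\bigl(\mathrm{coker}(F[\mathcal S_{<t}]\subset F)\bigr).$$ Moreover, if $t>0$ and this cokernel is tame, then it belongs to $B(F,t)$, so it realises the minimum defining $\mathrm{bar}(F)_t$. -/

import Mathlib

open CategoryTheory CategoryTheory.Limits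
open scoped NNRat NNReal ENNReal

noncomputable section

namespace Persistence

universe u

/-- Functors from the poset of non-negative rational numbers to `K`-vector spaces. -/
abbrev PFun (K : Type u) [Field K] := ℚ≥0 ⥤ ModuleCat.{u} K

variable {K : Type u} [Field K]

/-! ### Tame and compact functors -/

/-- `v ↦ ⌊v / α⌋`, the largest natural number `w` with `α * w ≤ v`. -/
def floorFunctor (α : ℚ≥0) : ℚ≥0 ⥤ ℕ :=
  Monotone.functor (f := fun v : ℚ≥0 => ⌊v / α⌋₊) fun _ _ h =>
    Nat.floor_mono (by gcongr)

/-- `G` is `α`-tame if it is isomorphic to the extension `v ↦ F ⌊v / α⌋` of some functor `F`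
indexed by the natural numbers. -/
def IsTameAt (α : ℚ≥0) (G : PFun K) : Prop :=
  ∃ F : ℕ ⥤ ModuleCat.{u} K, Nonempty (G ≅ floorFunctor α ⋙ F)

/-- A functor is tame if it is `α`-tame for some positive rational number `α`. -/
def IsTame (G : PFun K) : Prop :=
  ∃ α : ℚ≥0, 0 < α ∧ IsTameAt α G

/-- A subfunctor of `F`: a family of subspaces preserved by the structure maps. -/
@[ext]
structure Subfunctor (F : PFun K) where
  obj : ∀ v : ℚ≥0, Submodule K (F.obj v)
  map : ∀ {v w : ℚ≥0} (f : v ⟶ w), obj v ≤ (obj w).comap (F.map f).hom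

namespace Subfunctor

variable {F : PFun K}

/-- Subfunctors are ordered by inclusion. -/
instance : PartialOrder (Subfunctor F) :=
  PartialOrder.lift (fun N => N.obj) fun _ _ h => Subfunctor.ext h

/-- The functor underlying a subfunctor. -/
def toFunctor (N : Subfunctor F) : PFun K where
  obj v := ModuleCat.of K (N.obj v)
  map f := ModuleCat.ofHom ((F.map f).hom.restrict (N.map f))
  map_id v := by
    ext x
    simp
  map_comp f g := by
    ext x
    simp

/-- The inclusion of a subfunctor. -/
def ι (N : Subfunctor F) : N.toFunctor ⟶ F where
  app v := ModuleCat.ofHom (N.obj v).subtype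
  naturality _ _ _ := rfl

/-- The sum of a family of subfunctors (the union, if the family is a chain). -/
def iSum {J : Sort*} (N : J → Subfunctor F) : Subfunctor F where
  obj v := ⨆ j, (N j).obj v
  map f := iSup_le fun j => ((N j).map f).trans
    (Submodule.comap_mono (le_iSup (fun j => (N j).obj _) j))

theorem le_iSum {J : Sort*} (N : J → Subfunctor F) (j : J) : N j ≤ iSum N :=
  fun v => le_iSup (fun j => (N j).obj v) j

theorem iSum_le {J : Sort*} (N : J → Subfunctor F) (M : Subfunctor F) (h : ∀ j, N j ≤ M) :
    iSum N ≤ M :=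
  fun v => iSup_le fun j => h j v

end Subfunctor

/-- `F` is compact if every increasing sequence of subfunctors whose union (i.e. colimit) is `F`
reaches `F` at some finite stage. -/
def IsCompact (F : PFun K) : Prop :=
  ∀ A : ℕ → Subfunctor F, Monotone A →
    (∀ (v : ℚ≥0) (x : F.obj v), ∃ k, x ∈ (A k).obj v) →
    ∃ k, ∀ v : ℚ≥0, (A k).obj v = ⊤

/-! ### Rank -/

/-- The free functor `K(i,-)` on one generator in degree `i`: the linear span of the functor
represented by `i`. -/
def freeOn (K : Type u) [Field K] (i : ℚ≥0) : PFun K :=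
  coyoneda.obj (Opposite.op i) ⋙ uliftFunctor.{u} ⋙ ModuleCat.free K

/-- `φ` is minimal if every endomorphism `f` of its source with `φ f = φ` is an isomorphism. -/
def IsMinimalHom {P G : PFun K} (φ : P ⟶ G) : Prop :=
  ∀ f : P ⟶ P, f ≫ φ = φ → IsIso f

/-- `G` has finite rank `n`: it has a minimal cover by a free functor of rank `n`, that is by a
direct sum of `n` free functors on one generator. -/
def HasRank (G : PFun K) (n : ℕ) : Prop :=
  ∃ (i : Fin n → ℚ≥0) (φ : (∐ fun k => freeOn K (i k)) ⟶ G), Epi φ ∧ IsMinimalHom φ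

/-- The rank of `G`, equal to `⊤` if `G` is not of finite rank. -/
def rank (G : PFun K) : ℕ∞ :=
  ⨅ (n : ℕ) (_ : HasRank G n), (n : ℕ∞)

/-! ### Noise systems -/

/-- A noise system: `Small ε F` says that `F` belongs to the `ε`-component. -/
structure NoiseSystem (K : Type u) [Field K] where
  Small : ℚ≥0 → PFun K → Prop
  tame : ∀ ε F, Small ε F → IsTame F
  zero : ∀ ε F, IsZero F → Small ε F
  mono : ∀ τ ε F, τ < ε → Small τ F → Small ε F
  sub : ∀ ε (X : ShortComplex (PFun K)), X.ShortExact → IsTame X.X₁ → IsTame X.X₂ →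
    IsTame X.X₃ → Small ε X.X₂ → Small ε X.X₁
  quot : ∀ ε (X : ShortComplex (PFun K)), X.ShortExact → IsTame X.X₁ → IsTame X.X₂ →
    IsTame X.X₃ → Small ε X.X₂ → Small ε X.X₃
  add : ∀ ε τ (X : ShortComplex (PFun K)), X.ShortExact → IsTame X.X₁ → IsTame X.X₂ →
    IsTame X.X₃ → Small ε X.X₁ → Small τ X.X₃ → Small (ε + τ) X.X₂

namespace NoiseSystem

variable (S : NoiseSystem K)

/-- All components are closed under direct sums. -/
def ClosedUnderDirectSums : Prop :=
  ∀ ε F G, S.Small ε F → S.Small ε G → S.Small ε (F ⊞ G)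

/-- `φ` is an `ε`-equivalence. -/
def IsEquivalence (ε : ℚ≥0) {F G : PFun K} (φ : F ⟶ G) : Prop :=
  ∃ τ μ : ℚ≥0, τ + μ ≤ ε ∧ S.Small τ (kernel φ) ∧ S.Small μ (cokernel φ)

/-- `F` and `G` are `ε`-close. -/
def Close (ε : ℚ≥0) (F G : PFun K) : Prop :=
  ∃ (H : PFun K) (φ : H ⟶ F) (ψ : H ⟶ G) (τ μ : ℚ≥0),
    IsTame H ∧ S.IsEquivalence τ φ ∧ S.IsEquivalence μ ψ ∧ τ + μ ≤ ε

/-- The extended pseudometric on tame functors: the infimum of all `ε` such that `F` and `G` are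
`ε`-close (`∞` if there are none). -/
def dist (F G : PFun K) : ℝ≥0∞ :=
  ⨅ (ε : ℚ≥0) (_ : S.Close ε F G), ((ε : ℝ≥0) : ℝ≥0∞)

/-- The open ball `B(F,t)` in the set of tame functors. -/
def ball (F : PFun K) (t : ℚ≥0) : Set (PFun K) :=
  {G | IsTame G ∧ S.dist F G < ((t : ℝ≥0) : ℝ≥0∞)}

/-- The feature counting invariant `bar(F)_t`: the rank of `F` for `t = 0`, and the minimal rank
of a functor in `B(F,t)` for `t > 0`. -/
def bar (F : PFun K) (t : ℚ≥0) : ℕ∞ :=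
  if t = 0 then rank F else ⨅ G ∈ S.ball F t, rank G

/-- `F[S_τ]`: the sum of all subfunctors of `F` lying in the `τ`-component. It is the unique
maximal subfunctor of `F` lying in the `τ`-component whenever there is one, see
`maxNoise_eq_of_isGreatest`. -/
def maxNoise (F : PFun K) (τ : ℚ≥0) : Subfunctor F :=
  Subfunctor.iSum fun N : {N : Subfunctor F // S.Small τ N.toFunctor} => N.1

theorem maxNoise_eq_of_isGreatest {F : PFun K} {τ : ℚ≥0} {M : Subfunctor F}
    (hM : IsGreatest {N : Subfunctor F | S.Small τ N.toFunctor} M) : S.maxNoise F τ = M :=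
  le_antisymm (Subfunctor.iSum_le _ _ fun N => hM.2 N.2)
    (Subfunctor.le_iSum (fun N : {N : Subfunctor F // S.Small τ N.toFunctor} => N.1) ⟨M, hM.1⟩)

/-- `F[S_{<t}]`: the union of the subfunctors `F[S_τ]` for `τ < t`. -/
def noiseBelow (F : PFun K) (t : ℚ≥0) : Subfunctor F :=
  Subfunctor.iSum fun τ : {τ : ℚ≥0 // τ < t} => S.maxNoise F τ.1

theorem maxNoise_mono (F : PFun K) : Monotone (S.maxNoise F) := fun τ μ h =>
  Subfunctor.iSum_le _ _ fun N =>
    Subfunctor.le_iSum (fun N : {N : Subfunctor F // S.Small μ N.toFunctor} => N.1)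
      ⟨N.1, h.eq_or_lt.elim (fun e => e ▸ N.2) fun l => S.mono τ μ _ l N.2⟩

theorem mem_noiseBelow {F : PFun K} {t : ℚ≥0} (ht : 0 < t) {v : ℚ≥0} (x : F.obj v) :
    x ∈ (S.noiseBelow F t).obj v ↔ ∃ τ < t, x ∈ (S.maxNoise F τ).obj v := by
  have : Nonempty {τ : ℚ≥0 // τ < t} := ⟨⟨0, ht⟩⟩
  have hd : Directed (· ≤ ·) fun τ : {τ : ℚ≥0 // τ < t} => (S.maxNoise F τ.1).obj v :=
    Monotone.directed_le fun a b h => S.maxNoise_mono F h v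
  have h := Submodule.mem_iSup_of_directed _ hd (x := x)
  simp only [Subtype.exists, exists_prop] at h
  exact h

end NoiseSystem

end Persistence

end

noncomputable section

namespace Persistence

universe u

variable {K : Type u} [Field K]

/-! ### Elementwise criteria -/

/-! The rank of a functor is the least number of its generators (`hasRank_of_minimal`,
`HasRank.gen`), and a tame compact functor is finitely generated (`exists_gen_of_isCompact`). It
therefore suffices to compare numbers of generators. Write `P = F[S_{<t}]`.

Upper bound (`exists_mem_ball_rank_le`). Suppose `F/P` has `n` generators, and lift them to `F`.
Each of the finitely many generators of `F` is a combination of these lifts up to an error in `P`.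
Closure under direct sums puts all the errors into one subfunctor `N` in `S_τ` with `τ < t`. Then
`F/N` is still generated by the `n` lifts, and it lies in `B(F,t)`.

Lower bound (`gen_cokernel_noiseBelow`). Let `φ : H → F` and `ψ : H → G` witness closeness below
`t`, with `ker ψ ∈ S_c`, `coker φ ∈ S_b`, and `G` generated by `n` elements. As over a principal
ideal domain, the image of `H` in `G` needs at most `n` generators. So `im φ` is generated by `N =
φ(ker ψ) ∈ S_c` and `n` elements `h_1, …, h_n`. Let `L_k` consist of the elements of `F` whose class
modulo `N + ⟨h_1, …, h_k⟩` generates a functor in `S_b`. Then `L_n` is everything, because `coker φ`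
is small, and `L_0 ⊂ F[S_{c+b}] ⊂ P`.

The crucial point (`SmallMod.exists_sub_smul`) is that each step from `L_k` to `L_{k+1}` costs only
one element. A cyclic functor is governed by the parameter at which its generator dies, so smallness
modulo a subfunctor depends only on when an element enters it. Hence one element of least degree in
`L_{k+1}` outside `L_k` corrects all the others into `L_k`. Least degrees exist because tameness
reduces everything to a grid `γℕ`. -/

theorem injective_app_of_mono {F G : PFun K} (φ : F ⟶ G) [Mono φ] (v : ℚ≥0) :
    Function.Injective (φ.app v).hom :=
  (ModuleCat.mono_iff_injective _).1 ((NatTrans.mono_iff_mono_app φ).1 inferInstance v)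

theorem surjective_app_of_epi {F G : PFun K} (φ : F ⟶ G) [Epi φ] (v : ℚ≥0) :
    Function.Surjective (φ.app v).hom :=
  (ModuleCat.epi_iff_surjective _).1 ((NatTrans.epi_iff_epi_app φ).1 inferInstance v)

theorem mono_of_injective {F G : PFun K} (φ : F ⟶ G)
    (h : ∀ v, Function.Injective (φ.app v).hom) : Mono φ :=
  (NatTrans.mono_iff_mono_app φ).2 fun v => (ModuleCat.mono_iff_injective _).2 (h v)

theorem epi_of_surjective {F G : PFun K} (φ : F ⟶ G)
    (h : ∀ v, Function.Surjective (φ.app v).hom) : Epi φ :=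
  (NatTrans.epi_iff_epi_app φ).2 fun v => (ModuleCat.epi_iff_surjective _).2 (h v)

theorem comp_apply_of_eq_zero {F G H : PFun K} {φ : F ⟶ G} {ψ : G ⟶ H} (h : φ ≫ ψ = 0)
    (v : ℚ≥0) (x : F.obj v) : (ψ.app v).hom ((φ.app v).hom x) = 0 := by
  have := congrArg (fun η : F ⟶ H => (η.app v).hom x) h
  simpa using this

theorem shortExact_of_pointwise (X : ShortComplex (PFun K))
    (hf : ∀ v, Function.Injective (X.f.app v).hom)
    (hg : ∀ v, Function.Surjective (X.g.app v).hom)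
    (hfg : ∀ v (y : X.X₂.obj v), (X.g.app v).hom y = 0 → ∃ x, (X.f.app v).hom x = y) :
    X.ShortExact := by
  have := mono_of_injective _ hf
  have := epi_of_surjective _ hg
  refine ⟨?_⟩
  -- Exactness is tested by the vanishing of the composite from the kernel of `X.g` to the cokernel
  -- of `X.f`.
  rw [X.exact_iff_of_forks (kernelIsKernel X.g) (cokernelIsCokernel X.f)]
  ext v z
  obtain ⟨x, hx⟩ := hfg v (((kernel.ι X.g).app v).hom z)
    (comp_apply_of_eq_zero (kernel.condition _) v z)
  have := comp_apply_of_eq_zero (cokernel.condition X.f) v x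
  rw [hx] at this
  simpa using this

theorem exact_apply {X : ShortComplex (PFun K)} (hX : X.Exact) (v : ℚ≥0) (y : X.X₂.obj v)
    (hy : (X.g.app v).hom y = 0) : ∃ x, (X.f.app v).hom x = y :=
  (ShortComplex.moduleCat_exact_iff _).1 (hX.map ((evaluation ℚ≥0 (ModuleCat.{u} K)).obj v)) y hy

theorem exists_kernel_apply {F G : PFun K} (φ : F ⟶ G) {v : ℚ≥0} (x : F.obj v)
    (hx : (φ.app v).hom x = 0) : ∃ z, ((kernel.ι φ).app v).hom z = x :=
  exact_apply (ShortComplex.exact_kernel φ) v x hx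

theorem kernel_ι_apply {F G : PFun K} (φ : F ⟶ G) {v : ℚ≥0} (z : (kernel φ).obj v) :
    (φ.app v).hom (((kernel.ι φ).app v).hom z) = 0 :=
  comp_apply_of_eq_zero (kernel.condition φ) v z

theorem cokernel_π_apply_eq_zero_iff {F G : PFun K} (φ : F ⟶ G) {v : ℚ≥0} (y : G.obj v) :
    ((cokernel.π φ).app v).hom y = 0 ↔ ∃ x, (φ.app v).hom x = y := by
  refine ⟨exact_apply (ShortComplex.exact_cokernel φ) v y, ?_⟩
  rintro ⟨x, rfl⟩
  exact comp_apply_of_eq_zero (cokernel.condition φ) v x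

theorem shortExact_kernel {F G : PFun K} (φ : F ⟶ G) [Epi φ] :
    (ShortComplex.mk (kernel.ι φ) φ (kernel.condition φ)).ShortExact :=
  ⟨ShortComplex.exact_kernel φ⟩

theorem shortExact_cokernel {F G : PFun K} (φ : F ⟶ G) [Mono φ] :
    (ShortComplex.mk φ (cokernel.π φ) (cokernel.condition φ)).ShortExact :=
  ⟨ShortComplex.exact_cokernel φ⟩

/-! ### Structure maps -/

/-- The structure map `F(v) → F(w)` if `v ≤ w`, and zero otherwise. -/
def tr {F : PFun K} (v w : ℚ≥0) : F.obj v →ₗ[K] F.obj w :=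
  if h : v ≤ w then (F.map (homOfLE h)).hom else 0

theorem tr_of_le {F : PFun K} {v w : ℚ≥0} (h : v ≤ w) :
    (tr v w : F.obj v →ₗ[K] F.obj w) = (F.map (homOfLE h)).hom := dif_pos h

theorem tr_of_not_le {F : PFun K} {v w : ℚ≥0} (h : ¬ v ≤ w) :
    (tr v w : F.obj v →ₗ[K] F.obj w) = 0 := dif_neg h

@[simp]
theorem tr_self {F : PFun K} {v : ℚ≥0} (x : F.obj v) : tr v v x = x := by
  simp [tr_of_le le_rfl]

theorem tr_tr {F : PFun K} {v w u : ℚ≥0} (h : v ≤ w) (h' : w ≤ u) (x : F.obj v) :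
    tr w u (tr v w x : F.obj w) = tr v u x := by
  have := congrArg (fun η => η.hom x) (F.map_comp (homOfLE h) (homOfLE h'))
  rw [tr_of_le h, tr_of_le h', tr_of_le (h.trans h')]
  exact this.symm

theorem app_tr {F G : PFun K} (φ : F ⟶ G) (v w : ℚ≥0) (x : F.obj v) :
    (φ.app w).hom (tr v w x) = tr v w ((φ.app v).hom x) := by
  by_cases h : v ≤ w
  · rw [tr_of_le h, tr_of_le h]
    exact congrArg (fun η => η.hom x) (φ.naturality (homOfLE h))
  · simp [tr_of_not_le h]

theorem le_of_tr_ne_zero {F : PFun K} {v w : ℚ≥0} {x : F.obj v}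
    (h : (tr v w x : F.obj w) ≠ 0) : v ≤ w := by
  by_contra h'
  exact h (by simp [tr_of_not_le h'])

/-! ### Subfunctors -/

namespace Subfunctor

variable {F G : PFun K}

theorem tr_mem (N : Subfunctor F) {v w : ℚ≥0} {x : F.obj v} (hx : x ∈ N.obj v) :
    tr v w x ∈ N.obj w := by
  by_cases h : v ≤ w
  · rw [tr_of_le h]
    exact N.map _ hx
  · simp [tr_of_not_le h]

/-- A subfunctor from a family of subspaces closed under the structure maps. -/
def ofTr (N : ∀ v, Submodule K (F.obj v))
    (h : ∀ v w, v ≤ w → ∀ x ∈ N v, tr v w x ∈ N w) : Subfunctor F where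
  obj := N
  map {v w} f x hx := by
    have := h v w (leOfHom f) x hx
    rwa [tr_of_le (leOfHom f)] at this

instance (N : Subfunctor F) : Mono N.ι :=
  mono_of_injective _ fun v => (N.obj v).injective_subtype

/-- The zero subfunctor. -/
instance : Bot (Subfunctor F) := ⟨⟨fun _ => ⊥, fun f => by simp⟩⟩

/-- The whole functor as a subfunctor. -/
instance : Top (Subfunctor F) := ⟨⟨fun _ => ⊤, fun f => by simp⟩⟩

@[simp] theorem bot_obj (v : ℚ≥0) : (⊥ : Subfunctor F).obj v = ⊥ := rfl

@[simp] theorem top_obj (v : ℚ≥0) : (⊤ : Subfunctor F).obj v = ⊤ := rfl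

theorem le_top' (N : Subfunctor F) : N ≤ ⊤ := fun v => le_top (a := N.obj v)

theorem bot_le' (N : Subfunctor F) : ⊥ ≤ N := fun v => bot_le (a := N.obj v)

theorem eq_top_iff' {N : Subfunctor F} : N = ⊤ ↔ ∀ v x, x ∈ N.obj v := by
  refine ⟨fun h => by simp [h], fun h => ?_⟩
  ext v x
  simp [h]

/-- The sum of two subfunctors. -/
def sup (N M : Subfunctor F) : Subfunctor F where
  obj v := N.obj v ⊔ M.obj v
  map f := sup_le ((N.map f).trans (Submodule.comap_mono le_sup_left))
    ((M.map f).trans (Submodule.comap_mono le_sup_right))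

theorem le_sup_left' (N M : Subfunctor F) : N ≤ N.sup M :=
  fun v => le_sup_left (a := N.obj v)

theorem le_sup_right' (N M : Subfunctor F) : M ≤ N.sup M :=
  fun v => le_sup_right (a := N.obj v)

theorem sup_le' {N M P : Subfunctor F} (h : N ≤ P) (h' : M ≤ P) : N.sup M ≤ P :=
  fun v => sup_le (h v) (h' v)

/-- The preimage of a subfunctor. -/
def comap (φ : F ⟶ G) (N : Subfunctor G) : Subfunctor F :=
  ofTr (fun v => (N.obj v).comap (φ.app v).hom) fun v w _ x hx => by
    simpa only [Submodule.mem_comap, app_tr] using N.tr_mem hx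

/-- The image of a subfunctor. -/
def mapHom (φ : F ⟶ G) (N : Subfunctor F) : Subfunctor G :=
  ofTr (fun v => (N.obj v).map (φ.app v).hom) fun v w _ => by
    rintro _ ⟨x, hx, rfl⟩
    exact ⟨tr v w x, N.tr_mem hx, app_tr φ v w x⟩

theorem mem_mapHom {φ : F ⟶ G} {N : Subfunctor F} {v : ℚ≥0} {y : G.obj v} :
    y ∈ (mapHom φ N).obj v ↔ ∃ x ∈ N.obj v, (φ.app v).hom x = y := Iff.rfl

/-- The factorization of a natural transformation through a subfunctor. -/
def lift (N : Subfunctor G) (φ : F ⟶ G) (h : ∀ v x, (φ.app v).hom x ∈ N.obj v) :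
    F ⟶ N.toFunctor where
  app v := ModuleCat.ofHom ((φ.app v).hom.codRestrict (N.obj v) (h v))
  naturality v w f := by
    ext x
    apply Subtype.ext
    exact congrArg (fun η => η.hom x) (φ.naturality f)

@[simp]
theorem lift_ι (N : Subfunctor G) (φ : F ⟶ G) (h : ∀ v x, (φ.app v).hom x ∈ N.obj v) :
    N.lift φ h ≫ N.ι = φ := rfl

/-- The inclusion of a subfunctor into a larger one. -/
def inclusion {N M : Subfunctor F} (h : N ≤ M) : N.toFunctor ⟶ M.toFunctor :=
  M.lift N.ι fun v x => h v x.2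

instance {N M : Subfunctor F} (h : N ≤ M) : Mono (inclusion h) :=
  mono_of_mono_fac (M.lift_ι N.ι _)

/-- The subfunctor generated by an element. -/
def cyc {v : ℚ≥0} (x : F.obj v) : Subfunctor F :=
  ofTr (fun w => Submodule.span K {tr v w x}) fun w u h y hy => by
    obtain ⟨c, rfl⟩ := Submodule.mem_span_singleton.1 hy
    rw [map_smul]
    refine Submodule.smul_mem _ _ ?_
    by_cases hv : v ≤ w
    · rw [tr_tr hv h]
      exact Submodule.mem_span_singleton_self _
    · simp [tr_of_not_le hv]

theorem mem_cyc {v w : ℚ≥0} {x : F.obj v} {y : F.obj w} :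
    y ∈ (cyc x).obj w ↔ ∃ c : K, c • tr v w x = y := Submodule.mem_span_singleton

theorem self_mem_cyc {v : ℚ≥0} (x : F.obj v) : x ∈ (cyc x).obj v :=
  mem_cyc.2 ⟨1, by simp⟩

theorem cyc_le {N : Subfunctor F} {v : ℚ≥0} {x : F.obj v} (h : x ∈ N.obj v) : cyc x ≤ N := by
  intro w y hy
  obtain ⟨c, rfl⟩ := mem_cyc.1 hy
  exact Submodule.smul_mem _ _ (N.tr_mem h)

/-- The subfunctor generated by `N` and the first `n` elements of a sequence. -/
def filt (N : Subfunctor F) (g : ℕ → Σ v, F.obj v) : ℕ → Subfunctor F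
  | 0 => N
  | n + 1 => (filt N g n).sup (cyc (g n).2)

theorem le_filt (N : Subfunctor F) (g : ℕ → Σ v, F.obj v) (n : ℕ) : N ≤ filt N g n := by
  induction n with
  | zero => exact le_rfl
  | succ n ih => exact ih.trans (le_sup_left' _ _)

theorem mem_filt_succ {N : Subfunctor F} {g : ℕ → Σ v, F.obj v} {n : ℕ} {w : ℚ≥0}
    {y : F.obj w} : y ∈ (filt N g (n + 1)).obj w ↔
      ∃ c : K, y - c • tr (g n).1 w (g n).2 ∈ (filt N g n).obj w := by
  change y ∈ (filt N g n).obj w ⊔ Submodule.span K {tr (g n).1 w (g n).2} ↔ _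
  rw [Submodule.mem_sup]
  constructor
  · rintro ⟨a, ha, b, hb, rfl⟩
    obtain ⟨c, rfl⟩ := Submodule.mem_span_singleton.1 hb
    exact ⟨c, by simpa using ha⟩
  · rintro ⟨c, hc⟩
    exact ⟨_, hc, _, Submodule.mem_span_singleton.2 ⟨c, rfl⟩, by simp⟩

theorem mem_filt_iff {N : Subfunctor F} {g : ℕ → Σ v, F.obj v} {n : ℕ} {w : ℚ≥0}
    {y : F.obj w} : y ∈ (filt N g n).obj w ↔
      ∃ c : ℕ → K, y - ∑ k ∈ Finset.range n, c k • tr (g k).1 w (g k).2 ∈ N.obj w := by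
  induction n generalizing y with
  | zero => simp [filt]
  | succ n ih =>
    rw [mem_filt_succ]
    constructor
    · rintro ⟨a, ha⟩
      obtain ⟨c, hc⟩ := ih.1 ha
      refine ⟨Function.update c n a, ?_⟩
      rw [Finset.sum_range_succ, Function.update_self, Finset.sum_congr rfl (g := fun k =>
        c k • tr (g k).1 w (g k).2) fun k hk => by
          rw [Function.update_of_ne (Finset.mem_range.1 hk).ne]]
      rwa [sub_sub, add_comm] at hc
    · rintro ⟨c, hc⟩
      refine ⟨c n, ih.2 ⟨c, ?_⟩⟩
      rwa [Finset.sum_range_succ, add_comm, ← sub_sub] at hc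

theorem filt_le {N M : Subfunctor F} {g : ℕ → Σ v, F.obj v} {n : ℕ} (hN : N ≤ M)
    (hg : ∀ k < n, (g k).2 ∈ M.obj (g k).1) : filt N g n ≤ M := by
  induction n with
  | zero => exact hN
  | succ n ih => exact sup_le' (ih fun k hk => hg k (by omega)) (cyc_le (hg n (by omega)))

theorem mem_filt_self (N : Subfunctor F) (g : ℕ → Σ v, F.obj v) {k n : ℕ} (hk : k < n) :
    (g k).2 ∈ (filt N g n).obj (g k).1 := by
  induction n with
  | zero => omega
  | succ n ih =>
    rcases Nat.lt_succ_iff_lt_or_eq.1 hk with h | rfl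
    · exact le_sup_left' _ _ _ (ih h)
    · exact le_sup_right' _ _ _ (self_mem_cyc _)

theorem mapHom_filt (φ : F ⟶ G) (N : Subfunctor F) (g : ℕ → Σ v, F.obj v) (n : ℕ) :
    mapHom φ (filt N g n) =
      filt (mapHom φ N) (fun k => ⟨(g k).1, (φ.app (g k).1).hom (g k).2⟩) n := by
  apply le_antisymm
  · rintro w _ ⟨x, hx, rfl⟩
    obtain ⟨c, hc⟩ := mem_filt_iff.1 hx
    exact mem_filt_iff.2 ⟨c, _, hc, by simp [app_tr]⟩
  · refine filt_le ?_ fun k hk => ⟨_, mem_filt_self N g hk, rfl⟩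
    rintro w _ ⟨x, hx, rfl⟩
    exact ⟨x, le_filt _ _ _ _ hx, rfl⟩

end Subfunctor

/-- `F` is generated by `n` elements. -/
def Gen (F : PFun K) (n : ℕ) : Prop :=
  ∃ g : ℕ → Σ v, F.obj v, Subfunctor.filt ⊥ g n = ⊤

theorem Gen.of_epi {F G : PFun K} {n : ℕ} (h : Gen F n) (φ : F ⟶ G) [Epi φ] : Gen G n := by
  obtain ⟨g, hg⟩ := h
  have hb : Subfunctor.mapHom φ ⊥ = ⊥ := by
    ext w y
    simp [Subfunctor.mem_mapHom, eq_comm]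
  refine ⟨fun k => ⟨(g k).1, (φ.app (g k).1).hom (g k).2⟩, Subfunctor.eq_top_iff'.2 fun v y => ?_⟩
  obtain ⟨x, rfl⟩ := surjective_app_of_epi φ v y
  rw [← hb, ← Subfunctor.mapHom_filt, hg]
  exact ⟨x, trivial, rfl⟩

/-! ### Tameness in terms of structure maps -/

/-- The structure maps of `F` between parameters with the same `⌊v / γ⌋` are bijective. -/
def StepIso (γ : ℚ≥0) (F : PFun K) : Prop :=
  ∀ v w, v ≤ w → ⌊v / γ⌋₊ = ⌊w / γ⌋₊ → Function.Bijective (tr v w : F.obj v →ₗ[K] F.obj w)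

/-- `v` is a natural multiple of `γ`. -/
def OnGrid (γ v : ℚ≥0) : Prop := ∃ j : ℕ, v = γ * j

theorem grid_floor_le {γ : ℚ≥0} (hγ : 0 < γ) (v : ℚ≥0) : γ * (⌊v / γ⌋₊ : ℚ≥0) ≤ v := by
  have := Nat.floor_le (R := ℚ≥0) (a := v / γ) zero_le
  rwa [le_div_iff₀ hγ, mul_comm] at this

theorem floor_grid {γ : ℚ≥0} (hγ : 0 < γ) (j : ℕ) : ⌊γ * (j : ℚ≥0) / γ⌋₊ = j := by
  rw [mul_div_cancel_left₀ _ hγ.ne', Nat.floor_natCast]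

theorem grid_le_iff {γ : ℚ≥0} (hγ : 0 < γ) (j : ℕ) (v : ℚ≥0) :
    γ * (j : ℚ≥0) ≤ v ↔ j ≤ ⌊v / γ⌋₊ := by
  rw [Nat.le_floor_iff zero_le, le_div_iff₀ hγ, mul_comm]

/-- The inclusion `j ↦ γ * j` of the natural numbers. -/
def gridFunctor (γ : ℚ≥0) : ℕ ⥤ ℚ≥0 :=
  Monotone.functor (f := fun j : ℕ => γ * (j : ℚ≥0)) fun _ _ h => by dsimp only; gcongr

theorem StepIso.isIso_map {γ : ℚ≥0} {F : PFun K} (h : StepIso γ F) {v w : ℚ≥0} (f : v ⟶ w)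
    (hvw : ⌊v / γ⌋₊ = ⌊w / γ⌋₊) : IsIso (F.map f) := by
  have := h v w (leOfHom f) hvw
  rw [tr_of_le (leOfHom f)] at this
  exact (ConcreteCategory.isIso_iff_bijective _).2 this

/-- The functor is recovered from its restriction to the grid `γℕ`, through the maps `F(γ⌊v/γ⌋) →
F(v)`. Tameness thereby becomes a property that diagram chases can verify. -/
theorem isTameAt_iff {γ : ℚ≥0} (hγ : 0 < γ) {F : PFun K} : IsTameAt γ F ↔ StepIso γ F := by
  constructor
  · rintro ⟨F', ⟨e⟩⟩ v w hvw hf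
    have h1 : IsIso ((floorFunctor γ).map (homOfLE hvw)) := ⟨homOfLE hf.ge, rfl, rfl⟩
    have h2 : IsIso ((floorFunctor γ ⋙ F').map (homOfLE hvw)) := by
      dsimp only [Functor.comp_map]
      infer_instance
    have h3 : IsIso (F.map (homOfLE hvw)) := (NatIso.isIso_map_iff e _).2 h2
    rw [tr_of_le hvw]
    exact (ConcreteCategory.isIso_iff_bijective (F.map (homOfLE hvw))).1 h3
  · intro h
    let p (v : ℚ≥0) : (floorFunctor γ ⋙ gridFunctor γ).obj v ⟶ v := homOfLE (grid_floor_le hγ v)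
    have hi (v : ℚ≥0) : IsIso (F.map (p v)) := h.isIso_map _ (floor_grid hγ _)
    refine ⟨gridFunctor γ ⋙ F, ⟨(NatIso.ofComponents
      (F := floorFunctor γ ⋙ gridFunctor γ ⋙ F) (G := F) (fun v => asIso (F.map (p v))) fun {v w} f => ?_).symm⟩⟩
    exact (F.map_comp _ _).symm.trans (F.map_comp (p v) f)

theorem isTame_iff {F : PFun K} : IsTame F ↔ ∃ γ, 0 < γ ∧ StepIso γ F :=
  exists_congr fun _ => and_congr_right fun h => isTameAt_iff h

theorem StepIso.isTame {γ : ℚ≥0} {F : PFun K} (h : StepIso γ F) (hγ : 0 < γ) : IsTame F :=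
  isTame_iff.2 ⟨γ, hγ, h⟩

/-- A finer grid only strengthens the assumption of equal floors, because `⌊v/γ⌋` is the integer
quotient of `⌊v/(γ/m)⌋` by `m`. -/
theorem StepIso.div {γ : ℚ≥0} {F : PFun K} (h : StepIso γ F) (m : ℕ) (hm : 0 < m) :
    StepIso (γ / m) F := by
  intro v w hvw hf
  refine h v w hvw ?_
  have key (x : ℚ≥0) : ⌊x / γ⌋₊ = ⌊x / (γ / m)⌋₊ / m := by
    have hm' : (m : ℚ≥0) ≠ 0 := by exact_mod_cast hm.ne'
    rw [← Nat.floor_div_natCast]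
    congr 1
    field_simp
  rw [key, key, hf]

/-- Positive rationals are commensurable: the reciprocal of the product of the two denominators
divides both `γ` and `γ'`. -/
theorem exists_common_step {γ γ' : ℚ≥0} (hγ : 0 < γ) (hγ' : 0 < γ') : ∃ δ : ℚ≥0, 0 < δ ∧
    (∀ F : PFun K, StepIso γ F → StepIso δ F) ∧ (∀ F : PFun K, StepIso γ' F → StepIso δ F) := by
  have e1 := NNRat.num_div_den γ
  have e2 := NNRat.num_div_den γ'
  have n1 : 0 < γ.num := Nat.pos_of_ne_zero fun h => hγ.ne' (by rw [← e1, h]; simp)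
  have n2 : 0 < γ'.num := Nat.pos_of_ne_zero fun h => hγ'.ne' (by rw [← e2, h]; simp)
  have d1 := γ.den_pos
  have d2 := γ'.den_pos
  refine ⟨γ / ((γ.num * γ'.den : ℕ) : ℚ≥0), by positivity,
    fun F h => h.div _ (by positivity), fun F h => ?_⟩
  have : γ / ((γ.num * γ'.den : ℕ) : ℚ≥0) = γ' / ((γ'.num * γ.den : ℕ) : ℚ≥0) := by
    rw [div_eq_div_iff (by positivity) (by positivity)]
    rw [← e1, ← e2]
    push_cast
    field_simp
    simp
    ring
  rw [this]
  exact h.div _ (by positivity)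

theorem IsTame.exists_common {F G : PFun K} (hF : IsTame F) (hG : IsTame G) :
    ∃ γ, 0 < γ ∧ StepIso γ F ∧ StepIso γ G := by
  obtain ⟨a, ha, hF⟩ := isTame_iff.1 hF
  obtain ⟨b, hb, hG⟩ := isTame_iff.1 hG
  obtain ⟨γ, hγ, h1, h2⟩ := exists_common_step (K := K) ha hb
  exact ⟨γ, hγ, h1 F hF, h2 G hG⟩

theorem StepIso.of_shortExact₁ {γ : ℚ≥0} {X : ShortComplex (PFun K)} (hX : X.ShortExact)
    (h₂ : StepIso γ X.X₂) (h₃ : StepIso γ X.X₃) : StepIso γ X.X₁ := by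
  have := hX.mono_f
  intro v w hvw hf
  constructor
  · refine (injective_iff_map_eq_zero _).2 fun x hx => ?_
    apply injective_app_of_mono X.f v
    apply (h₂ v w hvw hf).1
    rw [← app_tr, hx, map_zero, map_zero, map_zero]
  · intro y
    obtain ⟨z, hz⟩ := (h₂ v w hvw hf).2 ((X.f.app w).hom y)
    obtain ⟨x, rfl⟩ := exact_apply hX.exact v z <| (h₃ v w hvw hf).1 <| by
      rw [← app_tr, hz, map_zero, comp_apply_of_eq_zero X.zero]
    refine ⟨x, injective_app_of_mono X.f w ?_⟩
    rw [app_tr, hz]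

theorem StepIso.of_shortExact₃ {γ : ℚ≥0} {X : ShortComplex (PFun K)} (hX : X.ShortExact)
    (h₁ : StepIso γ X.X₁) (h₂ : StepIso γ X.X₂) : StepIso γ X.X₃ := by
  have := hX.epi_g
  intro v w hvw hf
  constructor
  · refine (injective_iff_map_eq_zero _).2 fun x hx => ?_
    obtain ⟨y, rfl⟩ := surjective_app_of_epi X.g v x
    rw [← app_tr] at hx
    obtain ⟨z, hz⟩ := exact_apply hX.exact w _ hx
    obtain ⟨u, rfl⟩ := (h₁ v w hvw hf).2 z
    rw [app_tr] at hz
    rw [← (h₂ v w hvw hf).1 hz, comp_apply_of_eq_zero X.zero]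
  · intro y
    obtain ⟨z, rfl⟩ := surjective_app_of_epi X.g w y
    obtain ⟨x, rfl⟩ := (h₂ v w hvw hf).2 z
    exact ⟨(X.g.app v).hom x, (app_tr _ _ _ _).symm⟩

theorem StepIso.of_shortExact₂ {γ : ℚ≥0} {X : ShortComplex (PFun K)} (hX : X.ShortExact)
    (h₁ : StepIso γ X.X₁) (h₃ : StepIso γ X.X₃) : StepIso γ X.X₂ := by
  have := hX.mono_f
  have := hX.epi_g
  intro v w hvw hf
  constructor
  · refine (injective_iff_map_eq_zero _).2 fun x hx => ?_
    obtain ⟨z, rfl⟩ := exact_apply hX.exact v x <| (h₃ v w hvw hf).1 <| by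
      rw [← app_tr, hx, map_zero, map_zero]
    rw [← app_tr] at hx
    have : (tr v w z : X.X₁.obj w) = 0 := injective_app_of_mono X.f w (by rw [hx, map_zero])
    rw [(h₁ v w hvw hf).1 (this.trans (map_zero _).symm), map_zero]
  · intro y
    obtain ⟨z, hz⟩ := (h₃ v w hvw hf).2 ((X.g.app w).hom y)
    obtain ⟨x, rfl⟩ := surjective_app_of_epi X.g v z
    rw [← app_tr] at hz
    obtain ⟨a, ha⟩ := exact_apply hX.exact w (y - tr v w x) (by rw [map_sub, hz, sub_self])
    obtain ⟨b, rfl⟩ := (h₁ v w hvw hf).2 a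
    refine ⟨x + (X.f.app v).hom b, ?_⟩
    rw [map_add, ← app_tr, ha, add_sub_cancel]

theorem IsTame.of_shortExact₁ {X : ShortComplex (PFun K)} (hX : X.ShortExact)
    (h₂ : IsTame X.X₂) (h₃ : IsTame X.X₃) : IsTame X.X₁ := by
  obtain ⟨γ, hγ, h₂, h₃⟩ := h₂.exists_common h₃
  exact (StepIso.of_shortExact₁ hX h₂ h₃).isTame hγ

theorem IsTame.of_shortExact₃ {X : ShortComplex (PFun K)} (hX : X.ShortExact)
    (h₁ : IsTame X.X₁) (h₂ : IsTame X.X₂) : IsTame X.X₃ := by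
  obtain ⟨γ, hγ, h₁, h₂⟩ := h₁.exists_common h₂
  exact (StepIso.of_shortExact₃ hX h₁ h₂).isTame hγ

theorem IsTame.of_shortExact₂ {X : ShortComplex (PFun K)} (hX : X.ShortExact)
    (h₁ : IsTame X.X₁) (h₃ : IsTame X.X₃) : IsTame X.X₂ := by
  obtain ⟨γ, hγ, h₁, h₃⟩ := h₁.exists_common h₃
  exact (StepIso.of_shortExact₂ hX h₁ h₃).isTame hγ

/-! ### Subfunctors and generators on the grid -/

namespace Subfunctor

variable {F G : PFun K} {γ : ℚ≥0}

/-- The structure maps of the subfunctor `N` between parameters with the same `⌊v / γ⌋` are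
surjective. -/
def StepSurj (γ : ℚ≥0) (N : Subfunctor F) : Prop :=
  ∀ v w, v ≤ w → ⌊v / γ⌋₊ = ⌊w / γ⌋₊ → ∀ y ∈ N.obj w, ∃ x ∈ N.obj v, tr v w x = y

/-- Injectivity of the structure maps is inherited from `F`, so surjectivity is all that has to be
tracked for subfunctors. -/
theorem StepSurj.stepIso {N : Subfunctor F} (hN : StepSurj γ N) (hF : StepIso γ F) :
    StepIso γ N.toFunctor := by
  intro v w hvw hf
  constructor
  · refine (injective_iff_map_eq_zero _).2 fun x hx => ?_
    apply injective_app_of_mono N.ι v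
    apply (hF v w hvw hf).1
    rw [← app_tr, hx, map_zero, map_zero, map_zero]
  · rintro ⟨y, hy⟩
    obtain ⟨x, hx, rfl⟩ := hN v w hvw hf y hy
    exact ⟨⟨x, hx⟩, injective_app_of_mono N.ι w (app_tr N.ι v w _)⟩

theorem stepSurj_top (hF : StepIso γ F) : StepSurj γ (⊤ : Subfunctor F) := by
  intro v w hvw hf y _
  obtain ⟨x, rfl⟩ := (hF v w hvw hf).2 y
  exact ⟨x, trivial, rfl⟩

theorem StepSurj.sup {N M : Subfunctor F} (hN : StepSurj γ N) (hM : StepSurj γ M) :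
    StepSurj γ (N.sup M) := by
  intro v w hvw hf y hy
  obtain ⟨a, ha, b, hb, rfl⟩ := Submodule.mem_sup.1 hy
  obtain ⟨a', ha', rfl⟩ := hN v w hvw hf a ha
  obtain ⟨b', hb', rfl⟩ := hM v w hvw hf b hb
  exact ⟨a' + b', Submodule.add_mem_sup ha' hb', map_add _ _ _⟩

/-- For `i` on the grid, `i ≤ w` depends only on `⌊w/γ⌋`, so no generator is born strictly inside a
step. -/
theorem stepSurj_cyc (hγ : 0 < γ) {i : ℚ≥0} (hi : OnGrid γ i) (g : F.obj i) :
    StepSurj γ (cyc g) := by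
  intro v w hvw hf y hy
  obtain ⟨c, rfl⟩ := mem_cyc.1 hy
  refine ⟨c • tr i v g, mem_cyc.2 ⟨c, rfl⟩, ?_⟩
  rw [map_smul]
  by_cases h : i ≤ w
  · obtain ⟨j, rfl⟩ := hi
    rw [tr_tr ((grid_le_iff hγ j v).2 (hf ▸ (grid_le_iff hγ j w).1 h)) hvw]
  · simp [tr_of_not_le h, tr_of_not_le fun h' => h (h'.trans hvw)]

theorem StepSurj.filt (hγ : 0 < γ) {N : Subfunctor F} (hN : StepSurj γ N)
    {g : ℕ → Σ v, F.obj v} (hg : ∀ k, OnGrid γ (g k).1) (n : ℕ) : StepSurj γ (N.filt g n) := by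
  induction n with
  | zero => exact hN
  | succ n ih => exact ih.sup (stepSurj_cyc hγ (hg n) _)

theorem StepSurj.mapHom {N : Subfunctor F} (hN : StepSurj γ N) (φ : F ⟶ G) :
    StepSurj γ (mapHom φ N) := by
  rintro v w hvw hf _ ⟨y, hy, rfl⟩
  obtain ⟨x, hx, rfl⟩ := hN v w hvw hf y hy
  exact ⟨(φ.app v).hom x, ⟨x, hx, rfl⟩, (app_tr φ v w x).symm⟩

theorem stepSurj_comap_bot (φ : F ⟶ G) (hF : StepIso γ F) (hG : StepIso γ G) :
    StepSurj γ (comap φ ⊥) := by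
  intro v w hvw hf y hy
  obtain ⟨x, rfl⟩ := (hF v w hvw hf).2 y
  refine ⟨x, (hG v w hvw hf).1 ?_, rfl⟩
  rw [← app_tr, map_zero]
  exact hy

/-- A functor filtered by predicates with one-dimensional steps is generated, modulo the bottom
of the filtration, by one element for each step. -/
theorem exists_filt_eq_top (hγ : 0 < γ) (hF : StepIso γ F) (L : ℕ → ∀ v, F.obj v → Prop) (n : ℕ)
    (P : Subfunctor F) (hn : ∀ v (x : F.obj v), OnGrid γ v → L n v x)
    (hstep : ∀ k < n, ∀ v w (x : F.obj v) (y : F.obj w), OnGrid γ v → OnGrid γ w → v ≤ w →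
      L (k + 1) v x → ¬ L k v x → L (k + 1) w y → ∃ c : K, L k w (y - c • tr v w x))
    (h0 : ∀ v (x : F.obj v), OnGrid γ v → L 0 v x → x ∈ P.obj v) :
    ∃ g : ℕ → Σ v, F.obj v, (∀ k, OnGrid γ (g k).1) ∧ Subfunctor.filt P g n = ⊤ := by
  have key (k : ℕ) (hk : k < n) : ∃ e : Σ v, F.obj v, OnGrid γ e.1 ∧ ∀ w (y : F.obj w),
      OnGrid γ w → L (k + 1) w y → ∃ c : K, L k w (y - c • tr e.1 w e.2) := by
    -- The generator for this step is taken in the least grid degree where `L (k + 1)` exceeds `L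
    -- k`; every other element to be corrected then lives in a degree at least as large, as `hstep`
    -- requires. The predicates need not be closed under addition.
    by_cases h : ∃ j : ℕ, ∃ x : F.obj (γ * j), L (k + 1) _ x ∧ ¬ L k _ x
    · classical
      obtain ⟨x, hx, hx'⟩ := Nat.find_spec h
      refine ⟨⟨_, x⟩, ⟨_, rfl⟩, fun w y hw hy => ?_⟩
      by_cases hy' : L k w y
      · exact ⟨0, by simpa using hy'⟩
      · refine hstep k hk _ w x y ⟨_, rfl⟩ hw ?_ hx hx' hy
        obtain ⟨j, rfl⟩ := hw
        have := Nat.find_min' h ⟨y, hy, hy'⟩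
        gcongr
    -- The filtration does not jump here, and the zero element serves as generator.
    · push Not at h
      refine ⟨⟨0, 0⟩, ⟨0, by simp⟩, fun w y hw hy => ⟨0, ?_⟩⟩
      obtain ⟨j, rfl⟩ := hw
      simpa using h j y hy
  choose! g hg hgL using key
  -- Beyond `n` the sequence is padded by zero in degree `0`, so that every term is on the grid.
  let g' : ℕ → Σ v, F.obj v := fun k => if k < n then g k else ⟨0, 0⟩
  have hg' (k : ℕ) (hk : k < n) : g' k = g k := if_pos hk
  have mem (k : ℕ) (hk : k ≤ n) (w : ℚ≥0) (y : F.obj w) (hw : OnGrid γ w) (hy : L k w y) :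
      y ∈ (Subfunctor.filt P g' k).obj w := by
    induction k generalizing y with
    | zero => exact h0 w y hw hy
    | succ k ih =>
      obtain ⟨c, hc⟩ := hgL k hk w y hw hy
      rw [← hg' k hk] at hc
      exact mem_filt_succ.2 ⟨c, ih (by omega) _ hc⟩
  refine ⟨g', fun k => ?_, eq_top_iff'.2 fun w y => ?_⟩
  · by_cases hk : k < n
    · rw [hg' k hk]
      exact hg k hk
    · simp only [g', if_neg hk]
      exact ⟨0, by simp⟩
  · obtain ⟨x, rfl⟩ := (hF _ w (grid_floor_le hγ w) (floor_grid hγ _)).2 y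
    exact tr_mem _ (mem n le_rfl _ x ⟨_, rfl⟩ (hn _ x ⟨_, rfl⟩))

/-- A functor mapping to a functor with `n` generators has, modulo the kernel, `n` generators. -/
theorem exists_filt_comap_bot_eq_top (hγ : 0 < γ) (hF : StepIso γ F) (φ : F ⟶ G) {n : ℕ}
    (hG : Gen G n) :
    ∃ g : ℕ → Σ v, F.obj v, (∀ k, OnGrid γ (g k).1) ∧
      Subfunctor.filt (comap φ ⊥) g n = ⊤ := by
  obtain ⟨g, hg⟩ := hG
  refine exists_filt_eq_top hγ hF (fun k v x => (φ.app v).hom x ∈ (Subfunctor.filt ⊥ g k).obj v) n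
    (comap φ ⊥) (fun v x _ => by simp [hg]) ?_ fun v x _ h => h
  intro k _ v w x y _ _ hvw hx hx' hy
  obtain ⟨a, ha⟩ := mem_filt_succ.1 hx
  obtain ⟨b, hb⟩ := mem_filt_succ.1 hy
  have ha0 : a ≠ 0 := by
    rintro rfl
    exact hx' (by simpa using ha)
  have hi : (g k).1 ≤ v := by
    by_contra h
    rw [tr_of_not_le h] at ha
    exact hx' (by simpa using ha)
  -- Here `a ≠ 0` and `b` are the coefficients of the `k`-th generator in the images of `x` and `y`;
  -- this multiple cancels it.
  refine ⟨b / a, ?_⟩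
  have ha' := Submodule.smul_mem _ (b / a) (tr_mem (w := w) _ ha)
  rw [map_sub, map_smul, tr_tr hi hvw, smul_sub, smul_smul, div_mul_cancel₀ _ ha0] at ha'
  have := Submodule.sub_mem _ hb ha'
  rw [sub_sub_sub_cancel_right] at this
  rwa [map_sub, map_smul, app_tr]

end Subfunctor

/-! ### Free functors -/

/-- The generator of `K(i,-)`. -/
def freeGen (i : ℚ≥0) : (freeOn K i).obj i :=
  ModuleCat.freeMk (R := K) (X := ULift.{u} (i ⟶ i)) ⟨𝟙 i⟩

/-- The natural transformation `K(i,-) → F` given by an element of `F(i)`. -/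
def freeHom {F : PFun K} {i : ℚ≥0} (x : F.obj i) : freeOn K i ⟶ F where
  app v := ModuleCat.ofHom
    (Finsupp.linearCombination K fun f : ULift.{u} (i ⟶ v) => (F.map f.down).hom x)
  naturality v w f := by
    refine ModuleCat.free_hom_ext fun (a : ULift.{u} (i ⟶ v)) => ?_
    change Finsupp.linearCombination K (fun f : ULift.{u} (i ⟶ w) => (F.map f.down).hom x)
      (Finsupp.mapDomain (fun a : ULift.{u} (i ⟶ v) => (⟨a.down ≫ f⟩ : ULift.{u} (i ⟶ w)))
        (Finsupp.single a 1)) = (F.map f).hom (Finsupp.linearCombination K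
        (fun f : ULift.{u} (i ⟶ v) => (F.map f.down).hom x) (Finsupp.single a 1))
    rw [Finsupp.mapDomain_single, Finsupp.linearCombination_single,
      Finsupp.linearCombination_single, one_smul, one_smul]
    exact congrArg (fun η => η.hom x) (F.map_comp a.down f)

@[simp]
theorem freeHom_freeGen {F : PFun K} {i : ℚ≥0} (x : F.obj i) :
    ((freeHom x).app i).hom (freeGen i) = x := by
  change Finsupp.linearCombination K (fun f : ULift.{u} (i ⟶ i) => (F.map f.down).hom x)
    (Finsupp.single _ 1) = x
  simp

theorem exists_smul_freeGen {i v : ℚ≥0} (z : (freeOn K i).obj v) :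
    ∃ a : K, z = a • tr i v (freeGen i) := by
  by_cases h : i ≤ v
  · have hz : tr i v (freeGen i : (freeOn K i).obj i) =
        (Finsupp.single (⟨homOfLE h⟩ : ULift.{u} (i ⟶ v)) (1 : K) :) := by
      rw [tr_of_le h]
      exact Finsupp.mapDomain_single
    let z' : ULift.{u} (i ⟶ v) →₀ K := z
    refine ⟨z' ⟨homOfLE h⟩, ?_⟩
    rw [hz]
    change z' = z' ⟨homOfLE h⟩ • Finsupp.single (⟨homOfLE h⟩ : ULift.{u} (i ⟶ v)) (1 : K)
    ext f
    obtain rfl : f = ⟨homOfLE h⟩ := rfl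
    simp
  · refine ⟨0, ?_⟩
    rw [zero_smul]
    exact Finsupp.ext (M := K) (α := ULift.{u} (i ⟶ v)) fun f => (h (leOfHom f.down)).elim

theorem freeHom_app_smul {F : PFun K} {i v : ℚ≥0} (x : F.obj i) (a : K) :
    ((freeHom x).app v).hom (a • tr i v (freeGen i)) = a • tr i v x := by
  rw [map_smul, app_tr, freeHom_freeGen]

theorem freeOn_hom_ext {F : PFun K} {i : ℚ≥0} {φ ψ : freeOn K i ⟶ F}
    (h : (φ.app i).hom (freeGen i) = (ψ.app i).hom (freeGen i)) : φ = ψ := by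
  ext v : 2
  refine ModuleCat.hom_ext (LinearMap.ext fun z => ?_)
  obtain ⟨a, rfl⟩ := exists_smul_freeGen z
  rw [map_smul, map_smul, app_tr, app_tr, h]

theorem tr_const {V : ModuleCat.{u} K} (v w : ℚ≥0) (x : V) :
    tr (F := (Functor.const ℚ≥0).obj V) v w x = if v ≤ w then x else 0 := by
  split_ifs with h
  · rw [tr_of_le h]
    rfl
  · rw [tr_of_not_le h]
    rfl

section Coproduct

variable {n : ℕ} (i : Fin n → ℚ≥0)

/-- The `k`-th generator of a direct sum of free functors. -/
def sigmaGen (k : Fin n) : (∐ fun k => freeOn K (i k)).obj (i k) :=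
  ((Sigma.ι (fun k => freeOn K (i k)) k).app (i k)).hom (freeGen (i k))

/-- The natural transformation from a direct sum of free functors given by elements. -/
def sigmaDesc {F : PFun K} (x : ∀ k, F.obj (i k)) : (∐ fun k => freeOn K (i k)) ⟶ F :=
  Sigma.desc fun k => freeHom (x k)

theorem sigmaDesc_sigmaGen {F : PFun K} (x : ∀ k, F.obj (i k)) (k : Fin n) :
    ((sigmaDesc i x).app (i k)).hom (sigmaGen i k) = x k := by
  have := congrArg (fun η => (η.app (i k)).hom (freeGen (i k)))
    (Sigma.ι_desc (fun k => freeHom (x k)) k)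
  exact this.trans (freeHom_freeGen _)

theorem sigma_hom_ext {F : PFun K} {φ ψ : (∐ fun k => freeOn K (i k)) ⟶ F}
    (h : ∀ k, (φ.app (i k)).hom (sigmaGen i k) = (ψ.app (i k)).hom (sigmaGen i k)) : φ = ψ :=
  Sigma.hom_ext _ _ fun k => freeOn_hom_ext (h k)

theorem sigmaDesc_app_sum {F : PFun K} (x : ∀ k, F.obj (i k)) (v : ℚ≥0) (a : Fin n → K)
    (s : Finset (Fin n)) :
    ((sigmaDesc i x).app v).hom (∑ k ∈ s, a k • tr (i k) v (sigmaGen i k)) =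
      ∑ k ∈ s, a k • tr (i k) v (x k) := by
  rw [map_sum]
  refine Finset.sum_congr rfl fun k _ => ?_
  rw [map_smul, app_tr, sigmaDesc_sigmaGen]

/-- By the universal property, the inclusion of the subfunctor generated by the `sigmaGen i k` has a
section, so this subfunctor is everything. No explicit model of the coproduct is needed. -/
theorem exists_sum_sigmaGen {v : ℚ≥0} (z : (∐ fun k => freeOn K (i k)).obj v) :
    ∃ a : Fin n → K, z = ∑ k, a k • tr (i k) v (sigmaGen i k) := by
  let N : Subfunctor (∐ fun k => freeOn K (i k)) := Subfunctor.iSum fun k =>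
    Subfunctor.cyc (sigmaGen i k)
  have hN (k : Fin n) : sigmaGen i k ∈ N.obj (i k) :=
    Subfunctor.le_iSum (fun k => Subfunctor.cyc (sigmaGen i k)) k _ (Subfunctor.self_mem_cyc _)
  let y (k : Fin n) : N.toFunctor.obj (i k) := ⟨_, hN k⟩
  have hs : sigmaDesc i y ≫ N.ι = 𝟙 _ := sigma_hom_ext i fun k =>
    congrArg (N.ι.app (i k)).hom (sigmaDesc_sigmaGen i y k)
  have hz : z ∈ N.obj v := by
    have := congrArg (fun η => (η.app v).hom z) hs
    change (N.ι.app v).hom _ = z at this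
    rw [← this]
    exact Subtype.prop _
  change z ∈ ⨆ k, Submodule.span K {tr (i k) v (sigmaGen i k)} at hz
  rw [← Submodule.span_range_eq_iSup, Submodule.mem_span_range_iff_exists_fun] at hz
  obtain ⟨a, ha⟩ := hz
  exact ⟨a, ha.symm⟩

/-- The natural transformation from a direct sum of free functors to the constant functor given
by the coordinates. -/
def sigmaCoord : (∐ fun k => freeOn K (i k)) ⟶
    (Functor.const ℚ≥0).obj (ModuleCat.of K (Fin n → K)) :=
  sigmaDesc i fun k => (Pi.single k 1 : Fin n → K)

theorem sigmaCoord_injective (v : ℚ≥0) : Function.Injective ((sigmaCoord (K := K) i).app v).hom := by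
  refine (injective_iff_map_eq_zero _).2 fun z hz => ?_
  obtain ⟨a, rfl⟩ := exists_sum_sigmaGen i z
  rw [sigmaCoord, sigmaDesc_app_sum] at hz
  refine Finset.sum_eq_zero fun k _ => ?_
  by_cases h : i k ≤ v
  · have hz' : (∑ j, a j • (if i j ≤ v then Pi.single j 1 else 0) : Fin n → K) = 0 := by
      refine Eq.trans (Finset.sum_congr rfl fun j _ => ?_) hz
      exact congrArg (a j • ·)
        (tr_const (V := ModuleCat.of K (Fin n → K)) (i j) v (Pi.single j 1)).symm
    have ha := congrFun hz' k
    rw [Finset.sum_apply, Finset.sum_eq_single k (fun j _ hj => by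
      split_ifs <;> simp [Pi.single_eq_of_ne hj.symm]) (by simp)] at ha
    have : a k = 0 := by simpa [h] using ha
    rw [this, zero_smul]
  · rw [tr_of_not_le h, LinearMap.zero_apply, smul_zero]

/-- The coordinates embed the free functor into a constant functor, whose structure maps are
identities. -/
theorem sigma_tr_injective {v w : ℚ≥0} (h : v ≤ w) :
    Function.Injective (tr v w : (∐ fun k => freeOn K (i k)).obj v →ₗ[K] _) := by
  refine (injective_iff_map_eq_zero _).2 fun z hz => sigmaCoord_injective i v ?_
  have := app_tr (sigmaCoord i) v w z
  rw [hz, map_zero, tr_of_le h] at this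
  rw [map_zero]
  exact this.symm

/-- The values are finite-dimensional, so an injective endomorphism is pointwise surjective. -/
theorem isIso_of_sigma_injective (f : (∐ fun k => freeOn K (i k)) ⟶ ∐ fun k => freeOn K (i k))
    (h : ∀ v, Function.Injective (f.app v).hom) : IsIso f := by
  have := mono_of_injective f h
  have : Epi f := epi_of_surjective f fun v => by
    have : Module.Finite K ((∐ fun k => freeOn K (i k)).obj v) :=
      Module.Finite.of_injective (N := Fin n → K) ((sigmaCoord i).app v).hom
        (sigmaCoord_injective i v)
    exact LinearMap.injective_iff_surjective.1 (h v)
  exact isIso_of_mono_of_epi f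

end Coproduct

/-! ### Rank and generators -/

theorem Gen.of_fin {G : PFun K} {n : ℕ} (i : Fin n → ℚ≥0) (x : ∀ k, G.obj (i k))
    (h : ∀ N : Subfunctor G, (∀ k, x k ∈ N.obj (i k)) → N = ⊤) : Gen G n := by
  let g : ℕ → Σ v, G.obj v := fun k => if hk : k < n then ⟨i ⟨k, hk⟩, x ⟨k, hk⟩⟩ else ⟨0, 0⟩
  refine ⟨g, h _ fun k => ?_⟩
  have := Subfunctor.mem_filt_self ⊥ g k.2
  have hg : g k = ⟨i k, x k⟩ := dif_pos k.2
  rwa [hg] at this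

theorem HasRank.gen {G : PFun K} {n : ℕ} (h : HasRank G n) : Gen G n := by
  obtain ⟨i, φ, _, -⟩ := h
  refine Gen.of_fin i (fun k => (φ.app (i k)).hom (sigmaGen i k)) fun N hN => ?_
  refine Subfunctor.eq_top_iff'.2 fun v y => ?_
  obtain ⟨z, rfl⟩ := surjective_app_of_epi φ v y
  obtain ⟨a, rfl⟩ := exists_sum_sigmaGen i z
  rw [map_sum]
  refine Submodule.sum_mem _ fun k _ => ?_
  rw [map_smul, app_tr]
  exact Submodule.smul_mem _ _ (N.tr_mem (hN k))

/-- A minimal system of generators gives a minimal cover. -/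
theorem hasRank_of_minimal {G : PFun K} {n : ℕ} (h : Gen G n) (hn : ∀ m < n, ¬ Gen G m) :
    HasRank G n := by
  obtain ⟨g, hg⟩ := h
  let i : Fin n → ℚ≥0 := fun k => (g k).1
  let x : ∀ k, G.obj (i k) := fun k => (g k).2
  have hgen (N : Subfunctor G) (hN : ∀ k, x k ∈ N.obj (i k)) : N = ⊤ :=
    le_antisymm N.le_top' (hg ▸ Subfunctor.filt_le N.bot_le' fun k hk => hN ⟨k, hk⟩)
  refine ⟨i, sigmaDesc i x, epi_of_surjective _ fun v y => ?_, fun f hf => ?_⟩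
  · have := hgen (Subfunctor.mapHom (sigmaDesc i x) ⊤) fun k =>
      ⟨sigmaGen i k, trivial, sigmaDesc_sigmaGen i x k⟩
    obtain ⟨z, -, hz⟩ := Subfunctor.eq_top_iff'.1 this v y
    exact ⟨z, hz⟩
  · refine isIso_of_sigma_injective i f fun u => (injective_iff_map_eq_zero _).2 fun c hc => ?_
    by_contra hc0
    obtain ⟨a, rfl⟩ := exists_sum_sigmaGen i c
    classical
    -- These are the generators that really occur in the kernel element.
    let T : Finset (Fin n) := {k | a k ≠ 0 ∧ i k ≤ u}
    have hT : ∑ k, a k • tr (i k) u (sigmaGen (K := K) i k) =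
        ∑ k ∈ T, a k • tr (i k) u (sigmaGen i k) := by
      refine (Finset.sum_subset (Finset.subset_univ _) fun k _ hk => ?_).symm
      by_cases hak : a k = 0
      · rw [hak, zero_smul]
      · have : ¬ i k ≤ u := fun h => hk (by simp [T, hak, h])
        rw [tr_of_not_le this, LinearMap.zero_apply, smul_zero]
    rw [hT] at hc hc0
    have hne : T.Nonempty := Finset.nonempty_of_sum_ne_zero hc0
    -- The kernel element comes from degree `i k₀`, where the last of its generators is born. Since
    -- structure maps of free functors are injective, `f` already kills it there.
    obtain ⟨k₀, hk₀, hmax⟩ := T.exists_max_image i hne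
    have hk₀' : a k₀ ≠ 0 ∧ i k₀ ≤ u := by simpa [T] using hk₀
    have htr : tr (i k₀) u (∑ k ∈ T, a k • tr (i k) (i k₀) (sigmaGen (K := K) i k)) =
        ∑ k ∈ T, a k • tr (i k) u (sigmaGen i k) := by
      rw [map_sum]
      refine Finset.sum_congr rfl fun k hk => ?_
      rw [map_smul, tr_tr (hmax k hk) hk₀'.2]
    rw [← htr, app_tr] at hc
    have hz := sigma_tr_injective i hk₀'.2 (hc.trans (map_zero _).symm)
    have hφ := congrArg (fun η => (η.app (i k₀)).hom
      (∑ k ∈ T, a k • tr (i k) (i k₀) (sigmaGen (K := K) i k))) hf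
    change ((sigmaDesc i x).app _).hom ((f.app _).hom _) = ((sigmaDesc i x).app _).hom _ at hφ
    -- Since `φ f = φ`, this gives a relation in `G` in which `x k₀` itself, not a translate, has a
    -- nonzero coefficient. So `x k₀` is redundant, against the minimality of `n`.
    rw [hz, map_zero, sigmaDesc_app_sum, ← Finset.add_sum_erase _ _ hk₀, tr_self] at hφ
    obtain ⟨m, rfl⟩ : ∃ m, n = m + 1 := ⟨n - 1, by have := k₀.2; omega⟩
    refine hn m (Nat.lt_succ_self m) (Gen.of_fin (fun j => i (k₀.succAbove j))
      (fun j => x (k₀.succAbove j)) fun N hN => hgen N fun k => ?_)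
    have hN' (k) (hk : k ≠ k₀) : x k ∈ N.obj (i k) := by
      obtain ⟨j, rfl⟩ := Fin.exists_succAbove_eq hk
      exact hN j
    by_cases hk : k = k₀
    · subst hk
      refine (Submodule.smul_mem_iff _ hk₀'.1).1 ?_
      rw [eq_neg_of_add_eq_zero_left hφ.symm]
      refine Submodule.neg_mem _ (Submodule.sum_mem _ fun j hj => Submodule.smul_mem _ _ ?_)
      exact N.tr_mem (hN' j (Finset.ne_of_mem_erase hj))
    · exact hN' k hk

theorem Gen.rank_le {G : PFun K} {n : ℕ} (h : Gen G n) : rank G ≤ n := by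
  classical
  have h' : ∃ n, Gen G n := ⟨n, h⟩
  refine (iInf₂_le _ (hasRank_of_minimal (Nat.find_spec h') fun m => Nat.find_min h')).trans ?_
  exact_mod_cast Nat.find_min' h' h

theorem rank_le_rank {F G : PFun K} (h : ∀ n, Gen F n → Gen G n) : rank G ≤ rank F :=
  le_iInf₂ fun n hn => (h n hn.gen).rank_le

theorem rank_congr {F G : PFun K} (e : F ≅ G) : rank F = rank G :=
  le_antisymm (rank_le_rank fun _ h => h.of_epi e.inv) (rank_le_rank fun _ h => h.of_epi e.hom)

/-! ### Compact tame functors are finitely generated -/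

/-- With an infinite basis, the vectors whose coordinates at `e j` vanish for all `j ≥ k` form an
exhausting chain in `k` that never reaches the whole space: its `k`-th term misses the basis vector
`b (e k)`. -/
theorem finite_of_chain {V : Type*} [AddCommGroup V] [Module K V]
    (h : ∀ W : ℕ → Submodule K V, Monotone W → (∀ x, ∃ k, x ∈ W k) → ∃ k, W k = ⊤) :
    Module.Finite K V := by
  by_contra hV
  let b := Module.Basis.ofVectorSpace K V
  have : Infinite (Module.Basis.ofVectorSpaceIndex K V) := by
    by_contra hi
    rw [not_infinite_iff_finite] at hi
    exact hV (Module.Finite.of_basis b)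
  let e := Infinite.natEmbedding (Module.Basis.ofVectorSpaceIndex K V)
  let W : ℕ → Submodule K V := fun k => ⨅ (j : ℕ) (_ : k ≤ j), LinearMap.ker (b.coord (e j))
  have mem (k : ℕ) (x : V) : x ∈ W k ↔ ∀ j, k ≤ j → b.repr x (e j) = 0 := by
    simp [W, Submodule.mem_iInf]
  obtain ⟨k, hk⟩ := h W (fun k l hkl x hx => (mem l x).2 fun j hj => (mem k x).1 hx j (hkl.trans hj))
    fun x => by
      obtain ⟨k, hk⟩ := ((b.repr x).support.finite_toSet.preimage e.injective.injOn).bddAbove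
      refine ⟨k + 1, (mem _ x).2 fun j hj => ?_⟩
      by_contra hne
      have := hk (show j ∈ e ⁻¹' _ by simpa using hne)
      omega
  have := (mem k (b (e k))).1 (hk ▸ trivial) k le_rfl
  simp at this

/-- The span of the images of the structure maps into `F(d)` from smaller parameters. -/
def lowerImage (F : PFun K) (d : ℚ≥0) : Submodule K (F.obj d) :=
  ⨆ v : {v : ℚ≥0 // v < d}, LinearMap.range (tr v.1 d : F.obj v.1 →ₗ[K] F.obj d)

theorem tr_mem_lowerImage {F : PFun K} {v d : ℚ≥0} (h : v < d) (x : F.obj v) :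
    tr v d x ∈ lowerImage F d :=
  le_iSup (fun v : {v : ℚ≥0 // v < d} => LinearMap.range (tr v.1 d : F.obj v.1 →ₗ[K] F.obj d))
    ⟨v, h⟩ ⟨x, rfl⟩

/-- A chain of subspaces of the quotient lifts to a chain of subfunctors that are everything away
from degree `d`. These are closed under structure maps because whatever arrives in degree `d` from
below vanishes in the quotient. -/
theorem IsCompact.finite_quotient_lowerImage {F : PFun K} (hF : IsCompact F) (d : ℚ≥0) :
    Module.Finite K (F.obj d ⧸ lowerImage F d) := by
  refine finite_of_chain fun W hW hx => ?_
  let A : ℕ → Subfunctor F := fun k => Subfunctor.ofTr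
    -- The infimum over the proposition `v = d` is the whole space when `v ≠ d`.
    (fun v => ⨅ _ : v = d, ((W k).comap (lowerImage F d).mkQ).comap (tr v d)) fun v w hvw x hx => by
      rw [Submodule.mem_iInf] at hx ⊢
      rintro rfl
      rw [Submodule.mem_comap, tr_self]
      rcases hvw.eq_or_lt with rfl | h
      · exact hx rfl
      · have : (lowerImage F w).mkQ (tr v w x) = 0 :=
          (Submodule.Quotient.mk_eq_zero _).2 (tr_mem_lowerImage h x)
        rw [Submodule.mem_comap, this]
        exact zero_mem _
  have hA (k : ℕ) (v : ℚ≥0) (x : F.obj v) : x ∈ (A k).obj v ↔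
      v = d → (lowerImage F d).mkQ (tr v d x) ∈ W k := by
    change x ∈ (⨅ _ : v = d, ((W k).comap (lowerImage F d).mkQ).comap (tr v d) : Submodule K _) ↔ _
    simp only [Submodule.mem_iInf, Submodule.mem_comap]
  obtain ⟨k, hk⟩ := hF A
    (fun k l hkl v x hx => (hA l v x).2 fun h => hW hkl ((hA k v x).1 hx h))
    fun v x => (hx ((lowerImage F d).mkQ (tr v d x))).imp fun k hk => (hA k v x).2 fun _ => hk
  refine ⟨k, eq_top_iff.2 fun y _ => ?_⟩
  obtain ⟨x, rfl⟩ := (lowerImage F d).mkQ_surjective y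
  have := (hA k d x).1 (hk d ▸ trivial) rfl
  rwa [tr_self] at this

theorem IsCompact.exists_finset {F : PFun K} (hF : IsCompact F) (d : ℚ≥0) :
    ∃ s : Finset (F.obj d), lowerImage F d ⊔ Submodule.span K s = ⊤ := by
  classical
  obtain ⟨s, hs⟩ := (hF.finite_quotient_lowerImage d).fg_top
  obtain ⟨t, rfl⟩ : ∃ t : Finset (F.obj d), t.image (lowerImage F d).mkQ = s := by
    refine ⟨s.image (Function.surjInv (lowerImage F d).mkQ_surjective), ?_⟩
    rw [Finset.image_image]
    simp [Function.comp_def, Function.surjInv_eq]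
  refine ⟨t, ?_⟩
  rw [Finset.coe_image, Submodule.span_image] at hs
  rw [← Submodule.comap_map_mkQ, hs, Submodule.comap_top]

/-- Compactness is used twice: it bounds the degrees needed to generate `F`, and it makes the space
of new generators in each grid degree finite-dimensional. Only finitely many grid degrees lie below
the bound, and induction over them shows that the chosen elements generate. -/
theorem exists_gen_of_isCompact {F : PFun K} (hF : IsTame F) (hc : IsCompact F) :
    ∃ n, Gen F n := by
  classical
  obtain ⟨γ, hγ, hF⟩ := isTame_iff.1 hF
  choose s hs using fun j : ℕ => hc.exists_finset (γ * j)
  let A : ℕ → Subfunctor F := fun k => Subfunctor.iSum fun e : {e : Σ v, F.obj v // e.1 ≤ γ * k} =>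
    Subfunctor.cyc e.1.2
  have hA (k : ℕ) {v : ℚ≥0} (x : F.obj v) (hv : v ≤ γ * k) : x ∈ (A k).obj v :=
    Subfunctor.le_iSum (fun e : {e : Σ v, F.obj v // e.1 ≤ γ * (k : ℚ≥0)} =>
      Subfunctor.cyc e.1.2) ⟨⟨v, x⟩, hv⟩ v (Subfunctor.self_mem_cyc x)
  obtain ⟨k, hk⟩ := hc A
    (fun k l hkl => Subfunctor.iSum_le _ _ fun e => Subfunctor.cyc_le
      (hA l _ (e.2.trans (by gcongr))))
    fun v x => ⟨⌈v / γ⌉₊, hA _ x (by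
      have := Nat.le_ceil (v / γ)
      rwa [div_le_iff₀ hγ, mul_comm] at this)⟩
  let E : Finset (Σ v, F.obj v) := (Finset.range (k + 1)).biUnion fun j =>
    (s j).image fun x => ⟨γ * j, x⟩
  refine ⟨E.card, Gen.of_fin (fun m => (E.equivFin.symm m).1.1) (fun m => (E.equivFin.symm m).1.2)
    fun N hN => ?_⟩
  have hE (e : Σ v, F.obj v) (he : e ∈ E) : e.2 ∈ N.obj e.1 := by
    have := hN (E.equivFin ⟨e, he⟩)
    rwa [Equiv.symm_apply_apply] at this
  have grid (j : ℕ) (hj : j ≤ k) : N.obj (γ * j) = ⊤ := by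
    induction j using Nat.strong_induction_on with
    | _ j ih =>
      rw [eq_top_iff, ← hs j]
      refine sup_le (iSup_le ?_) (Submodule.span_le.2 fun x hx => ?_)
      · rintro ⟨v, hv⟩ _ ⟨x, rfl⟩
        have hlt : ⌊v / γ⌋₊ < j := by
          by_contra h
          exact not_le_of_gt hv ((grid_le_iff hγ j v).2 (not_lt.1 h))
        obtain ⟨y, rfl⟩ := (hF _ v (grid_floor_le hγ v) (floor_grid hγ _)).2 x
        refine N.tr_mem (N.tr_mem ?_)
        rw [ih _ hlt (by omega)]
        trivial
      · exact hE ⟨_, x⟩ (Finset.mem_biUnion.2 ⟨j, Finset.mem_range.2 (by omega),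
          Finset.mem_image_of_mem _ hx⟩)
  have hAN : A k ≤ N := Subfunctor.iSum_le _ _ fun ⟨⟨v, x⟩, hv⟩ => Subfunctor.cyc_le <| by
    obtain ⟨y, rfl⟩ := (hF _ v (grid_floor_le hγ v) (floor_grid hγ _)).2 x
    refine N.tr_mem ?_
    rw [grid _ ?_]
    · trivial
    · rw [← floor_grid hγ k]
      exact Nat.floor_mono (by dsimp only at hv; gcongr)
  exact Subfunctor.eq_top_iff'.2 fun v x => hAN v (show x ∈ (A k).obj v from hk v ▸ trivial)

/-! ### Noise systems -/

namespace NoiseSystem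

variable (S : NoiseSystem K)

theorem mono_le {τ ε : ℚ≥0} {F : PFun K} (h : τ ≤ ε) (hF : S.Small τ F) : S.Small ε F :=
  h.eq_or_lt.elim (fun e => e ▸ hF) fun l => S.mono τ ε F l hF

variable {S}

/-- Tameness of the subobject has to be assumed, since a subfunctor of a tame functor need not be
tame. -/
theorem small_of_mono {ε : ℚ≥0} {F G : PFun K} (φ : F ⟶ G) [Mono φ] (hF : IsTame F)
    (hG : S.Small ε G) : S.Small ε F :=
  S.sub ε _ (shortExact_cokernel φ) hF (S.tame _ _ hG)
    (IsTame.of_shortExact₃ (shortExact_cokernel φ) hF (S.tame _ _ hG)) hG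

theorem small_of_epi {ε : ℚ≥0} {F G : PFun K} (φ : F ⟶ G) [Epi φ] (hG : IsTame G)
    (hF : S.Small ε F) : S.Small ε G :=
  S.quot ε _ (shortExact_kernel φ)
    (IsTame.of_shortExact₁ (shortExact_kernel φ) (S.tame _ _ hF) hG) (S.tame _ _ hF) hG hF

theorem small_of_shortExact {ε τ : ℚ≥0} {X : ShortComplex (PFun K)} (hX : X.ShortExact)
    (h₁ : S.Small ε X.X₁) (h₃ : S.Small τ X.X₃) : S.Small (ε + τ) X.X₂ :=
  S.add ε τ X hX (S.tame _ _ h₁)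
    (IsTame.of_shortExact₂ hX (S.tame _ _ h₁) (S.tame _ _ h₃)) (S.tame _ _ h₃) h₁ h₃

theorem isTame_toFunctor_mapHom_top {F G : PFun K} (φ : F ⟶ G) (hF : IsTame F) (hG : IsTame G) :
    IsTame (Subfunctor.mapHom φ ⊤).toFunctor := by
  obtain ⟨γ, hγ, hF, hG⟩ := hF.exists_common hG
  exact (((Subfunctor.stepSurj_top hF).mapHom φ).stepIso hG).isTame hγ

theorem small_mapHom_top {ε : ℚ≥0} {F G : PFun K} (φ : F ⟶ G) (hF : S.Small ε F)
    (hG : IsTame G) : S.Small ε (Subfunctor.mapHom φ ⊤).toFunctor := by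
  let p := (Subfunctor.mapHom φ ⊤).lift φ fun v x => ⟨x, trivial, rfl⟩
  have : Epi p := epi_of_surjective _ fun v => by
    rintro ⟨_, x, -, rfl⟩
    exact ⟨x, rfl⟩
  exact small_of_epi p (isTame_toFunctor_mapHom_top φ (S.tame _ _ hF) hG) hF

theorem small_of_le {ε : ℚ≥0} {F : PFun K} {N M : Subfunctor F} (h : N ≤ M)
    (hN : IsTame N.toFunctor) (hM : S.Small ε M.toFunctor) : S.Small ε N.toFunctor :=
  small_of_mono (Subfunctor.inclusion h) hN hM

/-- The sum is the image of `N ⊕ M` in `F`, and images of small functors in tame ones are small. -/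
theorem small_sup (hS : S.ClosedUnderDirectSums) {ε : ℚ≥0} {F : PFun K} (hF : IsTame F)
    {N M : Subfunctor F} (hN : S.Small ε N.toFunctor) (hM : S.Small ε M.toFunctor) :
    S.Small ε (N.sup M).toFunctor := by
  let i₁ : N.toFunctor ⟶ N.toFunctor ⊞ M.toFunctor := biprod.inl
  let i₂ : M.toFunctor ⟶ N.toFunctor ⊞ M.toFunctor := biprod.inr
  let p₁ : N.toFunctor ⊞ M.toFunctor ⟶ N.toFunctor := biprod.fst
  let p₂ : N.toFunctor ⊞ M.toFunctor ⟶ M.toFunctor := biprod.snd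
  have h := small_mapHom_top (biprod.desc N.ι M.ι) (hS ε _ _ hN hM) hF
  have he : Subfunctor.mapHom (biprod.desc N.ι M.ι) ⊤ = N.sup M := by
    apply le_antisymm
    · rintro v _ ⟨x, -, rfl⟩
      have hx : x = (i₁.app v).hom ((p₁.app v).hom x) +
          (i₂.app v).hom ((p₂.app v).hom x) := by
        have := congrArg (fun η => (η.app v).hom x)
          (biprod.total (X := N.toFunctor) (Y := M.toFunctor))
        exact this.symm
      have e1 (y : N.toFunctor.obj v) :
          ((biprod.desc N.ι M.ι).app v).hom ((i₁.app v).hom y) = (N.ι.app v).hom y :=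
        congrArg (fun η => (η.app v).hom y) (biprod.inl_desc N.ι M.ι)
      have e2 (y : M.toFunctor.obj v) :
          ((biprod.desc N.ι M.ι).app v).hom ((i₂.app v).hom y) = (M.ι.app v).hom y :=
        congrArg (fun η => (η.app v).hom y) (biprod.inr_desc N.ι M.ι)
      rw [hx, map_add, e1, e2]
      exact Submodule.add_mem_sup (Subtype.prop _) (Subtype.prop _)
    · refine Subfunctor.sup_le' (fun v x hx => ?_) fun v x hx => ?_
      · exact ⟨(i₁.app v).hom (⟨x, hx⟩ : N.obj v), trivial,
          congrArg (fun η => (η.app v).hom (⟨x, hx⟩ : N.obj v)) (biprod.inl_desc N.ι M.ι)⟩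
      · exact ⟨(i₂.app v).hom (⟨x, hx⟩ : M.obj v), trivial,
          congrArg (fun η => (η.app v).hom (⟨x, hx⟩ : M.obj v)) (biprod.inr_desc N.ι M.ι)⟩
  rwa [he] at h

theorem small_bot (S : NoiseSystem K) (ε : ℚ≥0) {F : PFun K} :
    S.Small ε (⊥ : Subfunctor F).toFunctor := by
  refine S.zero _ _ ((IsZero.iff_id_eq_zero _).2 ?_)
  ext v x
  have : x = 0 := Subtype.ext ((Submodule.mem_bot K).1 x.2)
  rw [this, map_zero, map_zero]

theorem le_maxNoise {ε : ℚ≥0} {F : PFun K} {N : Subfunctor F} (h : S.Small ε N.toFunctor) :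
    N ≤ S.maxNoise F ε :=
  Subfunctor.le_iSum (fun N : {N : Subfunctor F // S.Small ε N.toFunctor} => N.1) ⟨N, h⟩

theorem maxNoise_le_noiseBelow (S : NoiseSystem K) (F : PFun K) {τ t : ℚ≥0} (h : τ < t) :
    S.maxNoise F τ ≤ S.noiseBelow F t :=
  Subfunctor.le_iSum (fun τ : {τ : ℚ≥0 // τ < t} => S.maxNoise F τ.1) ⟨τ, h⟩

theorem exists_small_of_mem_maxNoise (hS : S.ClosedUnderDirectSums) {F : PFun K} (hF : IsTame F)
    {τ v : ℚ≥0} {x : F.obj v} (hx : x ∈ (S.maxNoise F τ).obj v) :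
    ∃ N : Subfunctor F, S.Small τ N.toFunctor ∧ x ∈ N.obj v := by
  have : Nonempty {N : Subfunctor F // S.Small τ N.toFunctor} := ⟨⟨⊥, small_bot S τ⟩⟩
  have h := (Submodule.mem_iSup_of_directed (fun N : {N : Subfunctor F // S.Small τ N.toFunctor} =>
    N.1.obj v) fun N M => ⟨⟨N.1.sup M.1, small_sup hS hF N.2 M.2⟩,
      Subfunctor.le_sup_left' _ _ v, Subfunctor.le_sup_right' _ _ v⟩).1 hx
  obtain ⟨N, hN⟩ := h
  exact ⟨N.1, N.2, hN⟩

/-- Finitely many elements of `F[S_{<t}]` lie in a subfunctor belonging to some component below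
`t`. -/
theorem exists_small_of_mem_noiseBelow (hS : S.ClosedUnderDirectSums) {F : PFun K}
    (hF : IsTame F) {t : ℚ≥0} (ht : 0 < t) (g : ℕ → Σ v, F.obj v) (n : ℕ)
    (hg : ∀ k < n, (g k).2 ∈ (S.noiseBelow F t).obj (g k).1) :
    ∃ τ < t, ∃ N : Subfunctor F, S.Small τ N.toFunctor ∧ ∀ k < n, (g k).2 ∈ N.obj (g k).1 := by
  induction n with
  | zero => exact ⟨0, ht, ⊥, small_bot S 0, fun k hk => absurd hk (by omega)⟩
  | succ n ih =>
    obtain ⟨τ, hτ, N, hN, hgN⟩ := ih fun k hk => hg k (by omega)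
    obtain ⟨μ, hμ, hx⟩ := (S.mem_noiseBelow ht _).1 (hg n (by omega))
    obtain ⟨M, hM, hgM⟩ := exists_small_of_mem_maxNoise hS hF hx
    refine ⟨max τ μ, max_lt hτ hμ, N.sup M, small_sup hS hF (S.mono_le (le_max_left _ _) hN)
      (S.mono_le (le_max_right _ _) hM), fun k hk => ?_⟩
    rcases Nat.lt_succ_iff_lt_or_eq.1 hk with h | rfl
    · exact Subfunctor.le_sup_left' _ _ _ (hgN k h)
    · exact Subfunctor.le_sup_right' _ _ _ hgM

theorem close_of_small {F G : PFun K} {τ : ℚ≥0} (hF : IsTame F) (φ : F ⟶ G) [Epi φ]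
    (h : S.Small τ (kernel φ)) : S.Close τ F G := by
  refine ⟨F, 𝟙 F, φ, 0, τ, hF, ⟨0, 0, by simp, S.zero _ _ ?_, S.zero _ _ ?_⟩,
    ⟨τ, 0, by simp, h, S.zero _ _ ?_⟩, by simp⟩
  · exact isZero_kernel_of_mono _
  · exact isZero_cokernel_of_epi _
  · exact isZero_cokernel_of_epi _

theorem cokernel_mem_ball {F : PFun K} {τ t : ℚ≥0} (hF : IsTame F) (hτ : τ < t)
    {N : Subfunctor F} (hN : S.Small τ N.toFunctor) : cokernel N.ι ∈ S.ball F t := by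
  have ht := S.tame _ _ hN
  have hc : IsTame (cokernel N.ι) := IsTame.of_shortExact₃ (shortExact_cokernel N.ι) ht hF
  refine ⟨hc, ?_⟩
  have hk : S.Small τ (kernel (cokernel.π N.ι)) := by
    -- It is enough that the kernel of `F → F/N` is a tame quotient of `N`.
    let p : N.toFunctor ⟶ kernel (cokernel.π N.ι) := kernel.lift _ N.ι (cokernel.condition _)
    have : Epi p := epi_of_surjective _ fun v z => by
      obtain ⟨x, hx⟩ := (cokernel_π_apply_eq_zero_iff N.ι _).1 (kernel_ι_apply (cokernel.π N.ι) z)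
      refine ⟨x, injective_app_of_mono (kernel.ι (cokernel.π N.ι)) v ?_⟩
      rw [← hx]
      exact congrArg (fun η => (η.app v).hom x) (kernel.lift_ι _ N.ι (cokernel.condition _))
    exact small_of_epi p (IsTame.of_shortExact₁ (shortExact_kernel (cokernel.π N.ι)) hF hc) hN
  refine lt_of_le_of_lt (iInf₂_le τ (close_of_small hF (cokernel.π N.ι) hk)) ?_
  exact_mod_cast hτ

end NoiseSystem

/-! ### Elements generating small functors modulo a subfunctor -/

namespace NoiseSystem

variable {S : NoiseSystem K}

/-- The generator of the subfunctor generated by an element. -/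
def cycGen {F : PFun K} {w : ℚ≥0} (x : F.obj w) : (Subfunctor.cyc x).toFunctor.obj w :=
  ⟨x, Subfunctor.self_mem_cyc x⟩

theorem epi_freeHom_cycGen {F : PFun K} {w : ℚ≥0} (x : F.obj w) : Epi (freeHom (cycGen x)) := by
  refine epi_of_surjective _ fun u => ?_
  rintro ⟨y, hy⟩
  obtain ⟨c, rfl⟩ := Subfunctor.mem_cyc.1 hy
  refine ⟨c • tr w u (freeGen w), (freeHom_app_smul _ c).trans ?_⟩
  refine injective_app_of_mono (Subfunctor.cyc x).ι u ?_
  rw [map_smul, app_tr]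
  rfl

/-- If `x` generates a small functor, then so does every `y` in a larger degree that dies no
later than `x`. -/
theorem small_cyc_of_tr_eq_zero {F G : PFun K} {γ ε v w : ℚ≥0} (hγ : 0 < γ) (hF : StepIso γ F)
    (hG : StepIso γ G) (hw : OnGrid γ w) (hvw : v ≤ w) {x : F.obj v} {y : G.obj w}
    (hx : S.Small ε (Subfunctor.cyc x).toFunctor)
    (h : ∀ u, w ≤ u → (tr v u x : F.obj u) = 0 → (tr w u y : G.obj u) = 0) :
    S.Small ε (Subfunctor.cyc y).toFunctor := by
  let z : F.obj w := tr v w x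
  have hz : S.Small ε (Subfunctor.cyc z).toFunctor :=
    small_of_le (Subfunctor.cyc_le (Subfunctor.tr_mem _ (Subfunctor.self_mem_cyc x)))
      (((Subfunctor.stepSurj_cyc hγ hw z).stepIso hF).isTame hγ) hx
  let z' := cycGen z
  let y' := cycGen y
  have hp : Epi (freeHom z') := epi_freeHom_cycGen z
  have hq : Epi (freeHom y') := epi_freeHom_cycGen y
  -- The relations of `z` hold for `y`, so the functor generated by `y` is a quotient of the one
  -- generated by `z`.
  have h0 : kernel.ι (freeHom z') ≫ freeHom y' = 0 := by
    ext u k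
    change ((freeHom y').app u).hom (((kernel.ι (freeHom z')).app u).hom k) = 0
    have hk := kernel_ι_apply (freeHom z') k
    obtain ⟨a, ha⟩ := exists_smul_freeGen (((kernel.ι (freeHom z')).app u).hom k)
    rw [ha, freeHom_app_smul] at hk
    rw [ha, freeHom_app_smul]
    rcases eq_or_ne a 0 with rfl | ha0
    · rw [zero_smul]
    by_cases hu : w ≤ u
    · have h1 : (tr w u z' : (Subfunctor.cyc z).toFunctor.obj u) = 0 :=
        (smul_eq_zero.1 hk).resolve_left ha0
      have h2 : (tr w u z : F.obj u) = 0 := by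
        have := app_tr (Subfunctor.cyc z).ι w u z'
        rw [h1, map_zero] at this
        exact this.symm
      have h3 : (tr w u y' : (Subfunctor.cyc y).toFunctor.obj u) = 0 := by
        refine injective_app_of_mono (Subfunctor.cyc y).ι u ?_
        rw [app_tr, map_zero]
        exact h u hu (by rwa [tr_tr hvw hu] at h2)
      rw [h3, smul_zero]
    · rw [tr_of_not_le hu, LinearMap.zero_apply, smul_zero]
  let d := Abelian.epiDesc (freeHom z') (freeHom y') h0
  have hd : Epi d := epi_of_epi_fac (Abelian.comp_epiDesc (freeHom z') (freeHom y') h0)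
  exact small_of_epi d (((Subfunctor.stepSurj_cyc hγ hw y).stepIso hG).isTame hγ) hz

/-- The element `x` generates a small functor modulo `N`. -/
def SmallMod (S : NoiseSystem K) (ε : ℚ≥0) {F : PFun K} (N : Subfunctor F) {v : ℚ≥0}
    (x : F.obj v) : Prop :=
  S.Small ε (Subfunctor.cyc (((cokernel.π N.ι).app v).hom x)).toFunctor

theorem cokernel_π_tr_eq_zero_iff {F : PFun K} (N : Subfunctor F) {v w : ℚ≥0} (x : F.obj v) :
    (tr v w (((cokernel.π N.ι).app v).hom x) : (cokernel N.ι).obj w) = 0 ↔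
      tr v w x ∈ N.obj w := by
  rw [← app_tr, cokernel_π_apply_eq_zero_iff]
  exact ⟨fun ⟨y, hy⟩ => hy ▸ y.2, fun h => ⟨⟨_, h⟩, rfl⟩⟩

theorem stepIso_cokernel {F : PFun K} {γ : ℚ≥0} (hF : StepIso γ F) {N : Subfunctor F}
    (hN : N.StepSurj γ) : StepIso γ (cokernel N.ι) :=
  StepIso.of_shortExact₃ (shortExact_cokernel N.ι) (hN.stepIso hF) hF

/-- A class in `F/N` dies exactly when its representative enters `N`; this is
`small_cyc_of_tr_eq_zero` read in the two quotients. -/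
theorem SmallMod.of_imp {F : PFun K} {γ ε v w : ℚ≥0} (hγ : 0 < γ) (hF : StepIso γ F)
    {N M : Subfunctor F} (hN : N.StepSurj γ) (hM : M.StepSurj γ) (hw : OnGrid γ w) (hvw : v ≤ w)
    {x : F.obj v} {y : F.obj w} (hx : S.SmallMod ε N x)
    (h : ∀ u, w ≤ u → tr v u x ∈ N.obj u → tr w u y ∈ M.obj u) : S.SmallMod ε M y :=
  small_cyc_of_tr_eq_zero hγ (stepIso_cokernel hF hN) (stepIso_cokernel hF hM) hw hvw hx
    fun u hu h0 => (cokernel_π_tr_eq_zero_iff M y).2 (h u hu ((cokernel_π_tr_eq_zero_iff N x).1 h0))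

/-- Coefficients of multiples of `g` modulo `N` are compatible with the structure maps. -/
theorem coeff_eq_of_sub_mem {F : PFun K} (N : Subfunctor F) {i v p r : ℚ≥0} {g : F.obj i}
    {x : F.obj v} {a b : K} (hvp : v ≤ p) (hpr : p ≤ r)
    (ha : tr v p x - a • tr i p g ∈ N.obj p) (hb : tr v r x - b • tr i r g ∈ N.obj r)
    (hg : tr i r g ∉ N.obj r) (hgp : tr i p g ∉ N.obj p) : a = b := by
  have hi : i ≤ p := le_of_tr_ne_zero fun h => hgp (h ▸ zero_mem _)
  have ha' := N.tr_mem (w := r) ha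
  rw [map_sub, map_smul, tr_tr hvp hpr, tr_tr hi hpr] at ha'
  have := Submodule.sub_mem _ hb ha'
  rw [sub_sub_sub_cancel_left, ← sub_smul] at this
  by_contra hab
  exact hg ((Submodule.smul_mem_iff _ (sub_ne_zero.2 hab)).1 this)

/-- Elements small modulo a subfunctor with one additional generator are, up to multiples of a
single one of them, small modulo the original subfunctor. -/
theorem SmallMod.exists_sub_smul {F : PFun K} {γ ε v w i : ℚ≥0} (hγ : 0 < γ) (hF : StepIso γ F)
    {N : Subfunctor F} (hN : N.StepSurj γ) {g : F.obj i} (hi : OnGrid γ i) (hv : OnGrid γ v)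
    (hw : OnGrid γ w) (hvw : v ≤ w) {x : F.obj v} {y : F.obj w}
    (hx : S.SmallMod ε (N.sup (Subfunctor.cyc g)) x) (hx' : ¬ S.SmallMod ε N x)
    (hy : S.SmallMod ε (N.sup (Subfunctor.cyc g)) y) :
    ∃ c : K, S.SmallMod ε N (y - c • tr v w x) := by
  have hM : (N.sup (Subfunctor.cyc g)).StepSurj γ := hN.sup (Subfunctor.stepSurj_cyc hγ hi g)
  have mem {u : ℚ≥0} {z : F.obj u} (hz : z ∈ (N.sup (Subfunctor.cyc g)).obj u) :
      ∃ a : K, z - a • tr i u g ∈ N.obj u :=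
    Subfunctor.mem_filt_succ (N := N) (g := fun _ => ⟨i, g⟩) (n := 0).1 hz
  have not_mem {u : ℚ≥0} {z : F.obj u} {a : K} (hz : z - a • tr i u g ∈ N.obj u)
      (hz' : z ∉ N.obj u) : tr i u g ∉ N.obj u := fun h =>
    hz' (by simpa using Submodule.add_mem _ hz (Submodule.smul_mem _ a h))
  by_cases hy' : S.SmallMod ε N y
  · exact ⟨0, by simpa using hy'⟩
  -- If `x` lay in `N` whenever it lies in `N + ⟨g⟩`, it would be as small modulo `N` as modulo the
  -- sum. So at some `p` it is a nonzero multiple of `g` modulo `N`; likewise `y` at some `q`.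
  obtain ⟨p, hvp, hp, hp'⟩ : ∃ p, v ≤ p ∧ tr v p x ∈ (N.sup (Subfunctor.cyc g)).obj p ∧
      tr v p x ∉ N.obj p := by
    by_contra! h
    exact hx' (hx.of_imp hγ hF hM hN hv le_rfl h)
  obtain ⟨q, hwq, hq, hq'⟩ : ∃ q, w ≤ q ∧ tr w q y ∈ (N.sup (Subfunctor.cyc g)).obj q ∧
      tr w q y ∉ N.obj q := by
    by_contra! h
    exact hy' (hy.of_imp hγ hF hM hN hw le_rfl h)
  obtain ⟨a, ha⟩ := mem hp
  obtain ⟨b, hb⟩ := mem hq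
  have ha0 : a ≠ 0 := by
    rintro rfl
    exact hp' (by simpa using ha)
  -- Modulo `N`, `x` becomes `a g` and `y` becomes `b g`, so this multiple cancels `g`.
  refine ⟨b / a, ?_⟩
  have htr {u : ℚ≥0} (hu : w ≤ u) :
      tr w u (y - (b / a) • tr v w x) = tr w u y - (b / a) • (tr v u x : F.obj u) := by
    rw [map_sub, map_smul, tr_tr hvw hu]
  by_contra hs
  -- If the difference is not small modulo `N`, comparison with `x` and with `y` gives parameters
  -- where each has entered `N + ⟨g⟩` while the difference is outside `N`. The larger parameter
  -- works for both.
  obtain ⟨r, hr, hxr, hyr, hne⟩ : ∃ r, w ≤ r ∧ tr v r x ∈ (N.sup (Subfunctor.cyc g)).obj r ∧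
      tr w r y ∈ (N.sup (Subfunctor.cyc g)).obj r ∧
      tr w r (y - (b / a) • tr v w x) ∉ N.obj r := by
    obtain ⟨r₁, h₁, hx₁, hn₁⟩ : ∃ r, w ≤ r ∧ tr v r x ∈ (N.sup (Subfunctor.cyc g)).obj r ∧
        tr w r (y - (b / a) • tr v w x) ∉ N.obj r := by
      by_contra! h
      exact hs (hx.of_imp hγ hF hM hN hw hvw h)
    obtain ⟨r₂, h₂, hx₂, hn₂⟩ : ∃ r, w ≤ r ∧ tr w r y ∈ (N.sup (Subfunctor.cyc g)).obj r ∧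
        tr w r (y - (b / a) • tr v w x) ∉ N.obj r := by
      by_contra! h
      exact hs (hy.of_imp hγ hF hM hN hw le_rfl h)
    rcases le_total r₁ r₂ with h | h
    · refine ⟨r₂, h₂, ?_, hx₂, hn₂⟩
      rw [← tr_tr (hvw.trans h₁) h]
      exact Subfunctor.tr_mem _ hx₁
    · refine ⟨r₁, h₁, hx₁, ?_, hn₁⟩
      rw [← tr_tr h₂ h]
      exact Subfunctor.tr_mem _ hx₂
  rw [htr hr] at hne
  obtain ⟨a', ha'⟩ := mem hxr
  obtain ⟨b', hb'⟩ := mem hyr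
  have hgp := not_mem ha hp'
  have hgq := not_mem hb hq'
  have hgr : tr i r g ∉ N.obj r := fun h => hne <| Submodule.sub_mem _
    (by simpa using Submodule.add_mem _ hb' (Submodule.smul_mem _ b' h))
    (Submodule.smul_mem _ _ (by simpa using Submodule.add_mem _ ha' (Submodule.smul_mem _ a' h)))
  -- The coefficients at `r` agree with those at `p` and `q`, because `g` is outside `N` at all
  -- three parameters. The difference then lies in `N` at `r`, a contradiction.
  obtain rfl : a = a' := by
    rcases le_total p r with h | h
    · exact coeff_eq_of_sub_mem N hvp h ha ha' hgr hgp
    · exact (coeff_eq_of_sub_mem N (hvw.trans hr) h ha' ha hgp hgr).symm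
  obtain rfl : b = b' := by
    rcases le_total q r with h | h
    · exact coeff_eq_of_sub_mem N hwq h hb hb' hgr hgq
    · exact (coeff_eq_of_sub_mem N hr h hb' hb hgq hgr).symm
  refine hne ?_
  have := Submodule.sub_mem _ hb' (Submodule.smul_mem _ (b / a) ha')
  rwa [smul_sub, smul_smul, div_mul_cancel₀ _ ha0, sub_sub_sub_cancel_right] at this

/-- The short exact sequence `N → N + ⟨x⟩ → ⟨x mod N⟩` shows that `x` lies in a small subfunctor
if `N` is small and `x` is small modulo `N`. -/
theorem SmallMod.mem_maxNoise {F : PFun K} {N : Subfunctor F} {τ ε v : ℚ≥0} {x : F.obj v}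
    (hN : S.Small τ N.toFunctor) (hx : S.SmallMod ε N x) :
    x ∈ (S.maxNoise F (τ + ε)).obj v := by
  let M := N.sup (Subfunctor.cyc x)
  let π := cokernel.π N.ι
  have hπ {u : ℚ≥0} (z : F.obj u) : (π.app u).hom z = 0 ↔ z ∈ N.obj u := by
    have := cokernel_π_tr_eq_zero_iff N (w := u) z
    rwa [tr_self, tr_self] at this
  have hlift (u : ℚ≥0) (z : M.toFunctor.obj u) :
      ((M.ι ≫ π).app u).hom z ∈ (Subfunctor.cyc ((π.app v).hom x)).obj u := by
    obtain ⟨z, hz⟩ := z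
    obtain ⟨c, hc⟩ := Subfunctor.mem_filt_succ (N := N) (g := fun _ => ⟨v, x⟩) (n := 0).1 hz
    refine Subfunctor.mem_cyc.2 ⟨c, ?_⟩
    have := (hπ _).2 hc
    rw [map_sub, map_smul, app_tr] at this
    exact (sub_eq_zero.1 this).symm
  let q := Subfunctor.lift _ (M.ι ≫ π) hlift
  let j := Subfunctor.inclusion (N.le_sup_left' (Subfunctor.cyc x))
  have hjq : j ≫ q = 0 := by
    ext u z
    refine Subtype.ext ?_
    exact (hπ _).2 z.2
  have hX : (ShortComplex.mk j q hjq).ShortExact := by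
    refine shortExact_of_pointwise _ (injective_app_of_mono j) (fun u => ?_) fun u z hz => ?_
    · rintro ⟨y, hy⟩
      obtain ⟨c, rfl⟩ := Subfunctor.mem_cyc.1 hy
      refine ⟨⟨c • tr v u x, Submodule.smul_mem _ _ (Subfunctor.tr_mem _
        (Subfunctor.le_sup_right' _ _ _ (Subfunctor.self_mem_cyc x)))⟩, Subtype.ext ?_⟩
      change (π.app u).hom (c • tr v u x) = _
      rw [map_smul, app_tr]
    · have : (π.app u).hom z.1 = 0 := congrArg Subtype.val hz
      exact ⟨⟨z.1, (hπ _).1 this⟩, rfl⟩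
  exact le_maxNoise (small_of_shortExact hX hN hx) v
    (Subfunctor.le_sup_right' _ _ _ (Subfunctor.self_mem_cyc x))

end NoiseSystem

/-! ### Comparison of `F/F[S_{<t}]` with functors close to `F` -/

theorem gen_cokernel_iff {F : PFun K} (P : Subfunctor F) (n : ℕ) :
    Gen (cokernel P.ι) n ↔ ∃ l : ℕ → Σ v, F.obj v, P.filt l n = ⊤ := by
  let π := cokernel.π P.ι
  have hπ {u : ℚ≥0} (z : F.obj u) : (π.app u).hom z = 0 ↔ z ∈ P.obj u := by
    rw [cokernel_π_apply_eq_zero_iff]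
    exact ⟨fun ⟨y, hy⟩ => hy ▸ y.2, fun h => ⟨⟨_, h⟩, rfl⟩⟩
  have hsurj := surjective_app_of_epi π
  have hP : Subfunctor.mapHom π P = ⊥ := by
    refine le_antisymm ?_ (Subfunctor.bot_le' _)
    rintro v _ ⟨x, hx, rfl⟩
    exact (Submodule.mem_bot K).2 ((hπ x).2 hx)
  constructor
  · rintro ⟨g, hg⟩
    choose y hy using fun k => hsurj (g k).1 (g k).2
    refine ⟨fun k => ⟨(g k).1, y k⟩, Subfunctor.eq_top_iff'.2 fun v x => ?_⟩
    obtain ⟨c, hc⟩ := Subfunctor.mem_filt_iff.1 (Subfunctor.eq_top_iff'.1 hg v ((π.app v).hom x))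
    refine Subfunctor.mem_filt_iff.2 ⟨c, (hπ _).1 ?_⟩
    rw [map_sub, map_sum, ← (Submodule.mem_bot K).1 hc]
    congr 1
    refine Finset.sum_congr rfl fun k _ => ?_
    rw [map_smul, app_tr, hy]
  · rintro ⟨l, hl⟩
    refine ⟨fun k => ⟨(l k).1, (π.app _).hom (l k).2⟩, Subfunctor.eq_top_iff'.2 fun v y => ?_⟩
    obtain ⟨x, rfl⟩ := hsurj v y
    rw [← hP, ← Subfunctor.mapHom_filt, hl]
    exact ⟨x, trivial, rfl⟩

namespace NoiseSystem

variable {S : NoiseSystem K}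

/-- The quotient of `F` by the image of `φ` is a quotient of `coker φ`, and a generator on the grid
keeps the cyclic subfunctor tame. -/
theorem smallMod_mapHom_top {F H : PFun K} {γ ε v : ℚ≥0} (hγ : 0 < γ) (hF : StepIso γ F)
    (hH : StepIso γ H) (φ : H ⟶ F) (h : S.Small ε (cokernel φ)) (hv : OnGrid γ v) (x : F.obj v) :
    S.SmallMod ε (Subfunctor.mapHom φ ⊤) x := by
  have hC := stepIso_cokernel hF ((Subfunctor.stepSurj_top hH).mapHom φ)
  have h0 : φ ≫ cokernel.π (Subfunctor.mapHom φ ⊤).ι = 0 := by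
    ext u y
    exact (cokernel_π_apply_eq_zero_iff _ _).2 ⟨⟨_, y, trivial, rfl⟩, rfl⟩
  have : Epi (cokernel.desc φ _ h0) := epi_of_epi_fac (cokernel.π_desc φ _ h0)
  exact small_of_mono (Subfunctor.cyc _).ι
    (((Subfunctor.stepSurj_cyc hγ hv _).stepIso hC).isTame hγ)
    (small_of_epi (cokernel.desc φ _ h0) (hC.isTame hγ) h)

/-- A functor with `n` generators bounds the number of generators of `F / F[S_{<t}]` for every
functor `F` closer than `t`. -/
theorem gen_cokernel_noiseBelow {F G : PFun K} (hF : IsTame F) {ε t : ℚ≥0}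
    (h : S.Close ε F G) (hε : ε < t) {n : ℕ} (hG : IsTame G) (hn : Gen G n) :
    Gen (cokernel (S.noiseBelow F t).ι) n := by
  obtain ⟨H, φ, ψ, τ, μ, hH, ⟨a, b, hab, -, hb⟩, ⟨c, d, hcd, hc, -⟩, hτμ⟩ := h
  obtain ⟨γ₁, hγ₁, hF₁, hG₁⟩ := hF.exists_common hG
  obtain ⟨γ₂, hγ₂, hH₂⟩ := isTame_iff.1 hH
  obtain ⟨γ, hγ, h1, h2⟩ := exists_common_step (K := K) hγ₁ hγ₂
  replace hF₁ := h1 F hF₁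
  replace hG₁ := h1 G hG₁
  replace hH₂ := h2 H hH₂
  obtain ⟨h, hh, hhtop⟩ := Subfunctor.exists_filt_comap_bot_eq_top hγ hH₂ ψ hn
  -- `N` is `φ(ker ψ)`, a tame quotient of `ker ψ`, hence in the component `c`.
  let N := Subfunctor.mapHom φ (Subfunctor.comap ψ ⊥)
  have hNs : N.StepSurj γ := (Subfunctor.stepSurj_comap_bot ψ hH₂ hG₁).mapHom φ
  have hN : S.Small c N.toFunctor := by
    have he : N = Subfunctor.mapHom (kernel.ι ψ ≫ φ) ⊤ := by
      apply le_antisymm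
      · rintro v _ ⟨x, hx, rfl⟩
        obtain ⟨z, rfl⟩ := exists_kernel_apply ψ x ((Submodule.mem_bot K).1 hx)
        exact ⟨z, trivial, rfl⟩
      · rintro v _ ⟨z, -, rfl⟩
        exact ⟨_, (Submodule.mem_bot K).2 (kernel_ι_apply ψ z), rfl⟩
    rw [he]
    exact small_mapHom_top _ hc hF
  let h' : ℕ → Σ v, F.obj v := fun k => ⟨(h k).1, (φ.app _).hom (h k).2⟩
  have hN' (k : ℕ) : (N.filt h' k).StepSurj γ := hNs.filt hγ (fun j => hh j) k
  have htop : N.filt h' n = Subfunctor.mapHom φ ⊤ := by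
    rw [← hhtop, Subfunctor.mapHom_filt]
  -- The top of this filtration is all of `F` in grid degrees because `coker φ` is small. Its bottom
  -- lies in `F[S_{c+b}]` by additivity along extensions, and `c + b ≤ ε < t`.
  obtain ⟨l, -, hl⟩ := Subfunctor.exists_filt_eq_top hγ hF₁
    (fun k v x => S.SmallMod b (N.filt h' k) x) n (S.noiseBelow F t)
    (fun v x hv => by
      rw [htop]
      exact smallMod_mapHom_top hγ hF₁ hH₂ φ hb hv x)
    (fun k _ v w x y hv hw hvw hx hx' hy =>
      SmallMod.exists_sub_smul hγ hF₁ (hN' k) (hh k) hv hw hvw hx hx' hy)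
    fun v x _ hx => maxNoise_le_noiseBelow S F (by
      refine lt_of_le_of_lt ?_ hε
      calc c + b ≤ (c + d) + (a + b) := add_le_add le_self_add le_add_self
        _ ≤ μ + τ := add_le_add hcd hab
        _ ≤ ε := by rwa [add_comm]) v (SmallMod.mem_maxNoise hN hx)
  exact (gen_cokernel_iff _ n).2 ⟨l, hl⟩

theorem rank_cokernel_noiseBelow_le {F G : PFun K} (hF : IsTame F) {t : ℚ≥0}
    (hG : G ∈ S.ball F t) : rank (cokernel (S.noiseBelow F t).ι) ≤ rank G := by
  obtain ⟨hG, hd⟩ := hG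
  obtain ⟨ε, hε⟩ := iInf_lt_iff.1 hd
  obtain ⟨hc, hε⟩ := iInf_lt_iff.1 hε
  exact rank_le_rank fun n hn => gen_cokernel_noiseBelow hF hc (by exact_mod_cast hε) hG hn

/-- The full `F[S_{<t}]` need not be small or have a tame quotient. Only the finitely many elements
expressing the generators of `F` through lifted generators of the quotient have to be killed, and
these lie in one small subfunctor. -/
theorem exists_mem_ball_rank_le (hS : S.ClosedUnderDirectSums) {F : PFun K} (hF : IsTame F)
    {m n : ℕ} (hm : Gen F m) {t : ℚ≥0} (ht : 0 < t)
    (hn : Gen (cokernel (S.noiseBelow F t).ι) n) : ∃ G ∈ S.ball F t, rank G ≤ n := by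
  obtain ⟨l, hl⟩ := (gen_cokernel_iff _ n).1 hn
  obtain ⟨f, hf⟩ := hm
  choose c hc using fun k => Subfunctor.mem_filt_iff.1 (Subfunctor.eq_top_iff'.1 hl _ (f k).2)
  obtain ⟨τ, hτ, N, hN, hfN⟩ := exists_small_of_mem_noiseBelow hS hF ht
    (fun k => ⟨(f k).1, (f k).2 - ∑ j ∈ Finset.range n, c k j • tr (l j).1 (f k).1 (l j).2⟩) m
    fun k _ => hc k
  refine ⟨_, cokernel_mem_ball hF hτ hN, Gen.rank_le ((gen_cokernel_iff N n).2 ⟨l, ?_⟩)⟩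
  refine le_antisymm (Subfunctor.le_top' _) (hf ▸ Subfunctor.filt_le (Subfunctor.bot_le' _)
    fun k hk => Subfunctor.mem_filt_iff.2 ⟨c k, hfN k hk⟩)

/-- A tame quotient makes `F[S_{<t}]` itself tame, hence finitely generated as a subfunctor of the
finitely generated `F`. Its generators lie in one subfunctor from a component below `t`, which must
then be all of it. -/
theorem cokernel_noiseBelow_mem_ball (hS : S.ClosedUnderDirectSums) {F : PFun K} (hF : IsTame F)
    {m : ℕ} (hm : Gen F m) {t : ℚ≥0} (ht : 0 < t)
    (hC : IsTame (cokernel (S.noiseBelow F t).ι)) :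
    cokernel (S.noiseBelow F t).ι ∈ S.ball F t := by
  let P := S.noiseBelow F t
  obtain ⟨γ, hγ, hP⟩ := isTame_iff.1 (IsTame.of_shortExact₁ (shortExact_cokernel P.ι) hF hC)
  obtain ⟨g, -, hg⟩ := Subfunctor.exists_filt_comap_bot_eq_top hγ hP P.ι hm
  obtain ⟨τ, hτ, N, hN, hgN⟩ := exists_small_of_mem_noiseBelow hS hF ht
    (fun k => ⟨(g k).1, (P.ι.app _).hom (g k).2⟩) m fun k _ => (g k).2.2
  have hle : (⊤ : Subfunctor P.toFunctor) ≤ Subfunctor.comap P.ι N := by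
    rw [← hg]
    refine Subfunctor.filt_le (fun v x hx => ?_) hgN
    exact Subfunctor.bot_le' N v hx
  have hPN : N = P := le_antisymm
    ((le_maxNoise hN).trans (maxNoise_le_noiseBelow S F hτ))
    fun v x hx => hle v (x := (⟨x, hx⟩ : P.obj v)) trivial
  have := cokernel_mem_ball hF hτ hN
  rwa [hPN] at this

theorem rank_cokernel_noiseBelow_zero (S : NoiseSystem K) (F : PFun K) :
    rank F = rank (cokernel (S.noiseBelow F 0).ι) := by
  have hbot (v : ℚ≥0) : (S.noiseBelow F 0).obj v = ⊥ :=
    eq_bot_iff.2 (iSup_le fun τ => absurd τ.2 not_lt_zero)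
  have : Mono (cokernel.π (S.noiseBelow F 0).ι) := mono_of_injective _ fun v =>
    (injective_iff_map_eq_zero _).2 fun x hx => by
      obtain ⟨y, rfl⟩ := (cokernel_π_apply_eq_zero_iff _ _).1 hx
      exact (Submodule.mem_bot K).1 (hbot v ▸ y.2)
  have : IsIso (cokernel.π (S.noiseBelow F 0).ι) := isIso_of_mono_of_epi _
  exact rank_congr (asIso (cokernel.π (S.noiseBelow F 0).ι))

end NoiseSystem

end Persistence

end

theorem mainTheorem4 {K : Type*} [Field K] (S : Persistence.NoiseSystem K)
    (hS : S.ClosedUnderDirectSums) (F : Persistence.PFun K)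
    (hF : Persistence.IsTame F) (hFc : Persistence.IsCompact F) (t : ℚ≥0) :
    S.bar F t = Persistence.rank (cokernel (S.noiseBelow F t).ι) ∧
      Persistence.rank (cokernel (S.noiseBelow F t).ι) ≠ ⊤ ∧
      (0 < t → Persistence.IsTame (cokernel (S.noiseBelow F t).ι) →
        cokernel (S.noiseBelow F t).ι ∈ S.ball F t) := by
  obtain ⟨m, hm⟩ := Persistence.exists_gen_of_isCompact hF hFc
  refine ⟨?_, ne_top_of_le_ne_top (ENat.natCast_ne_top m)
    (hm.of_epi (cokernel.π (S.noiseBelow F t).ι)).rank_le,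
    fun ht hC => Persistence.NoiseSystem.cokernel_noiseBelow_mem_ball hS hF hm ht hC⟩
  unfold Persistence.NoiseSystem.bar
  split_ifs with ht
  · subst ht
    exact S.rank_cokernel_noiseBelow_zero F
  · refine le_antisymm (le_iInf₂ fun n hn => ?_)
      (le_iInf₂ fun G hG => Persistence.NoiseSystem.rank_cokernel_noiseBelow_le hF hG)
    obtain ⟨G, hG, hr⟩ := Persistence.NoiseSystem.exists_mem_ball_rank_le hS hF hm
      (pos_iff_ne_zero.2 ht) hn.gen
    exact (iInf₂_le G hG).trans hr
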